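/- All graphs are finite and simple; $d(u,v)$ is the distance and $d(G)$ the diameter. The radio number $rn(G)$ is the minimum of $\mathrm{span}(f)=\max_{u,v}|f(u)-f(v)|$ over all $f:V(G)\to\{0,1,2,\dots\}$ with $|f(u)-f(v)|\ge d(G)+1-d(u,v)$ for all distinct vertices $u,v$. A block of a graph is a maximal connected induced subgraph having no cut-vertex of its own; a block graph is a connected graph all of whose blocks are cliques. The weight of a vertex $v$ is $\sum_{u\in V(G)} d(u,v)$, and $W(G)$ is the set of vertices of minimum weight (weight centers). Put $\varepsilon(G)=1$ if $|W(G)|=1$ and $\varepsilon(G)=0$ otherwise. The central vertices of a block graph $G$ are the unique weight center if $|W(G)|=1$, and all vertices of the block containing $W(G)$ if $|W(G)|\ge 2$. The level of a vertex is its distance to the nearest central vertex, and $L(G)$ is the sum of the levels of all vertices. A block graph $G$ of order $p$ is a lower bound block graph if $$rn(G)=(p-1)\bigl(d(G)+\varepsilon(G)\bigr)-2L(G)+\varepsilon(G).$$ For $h\ge 1$, $n\ge 2$, the path of cliques $P_{h,n}$ is obtained from the path with $h$ edges by adding, for each edge $e=uv$ of the path, $n-2$ new vertices that together with $u,v$ form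 a clique; a tail vertex of $P_{h,n}$ is a vertex whose eccentricity equals the diameter of $P_{h,n}$. For $m,k\ge 1$, the extended star of blocks $S^m_{k,h,n}$ is obtained from the complete graph $K_m$ by identifying with each vertex $w$ of $K_m$ one tail vertex of each of $k$ copies of $P_{h,n}$ (separate copies for each $w$). **Theorem 6.** Let $m,k,h\ge 1$ and $n\ge 2$ be integers, where $k\ge 3$ if $m=1$, and $n=2$ if $(m,k)=(2,1)$. Let $G=S^m_{k,h,n}$. Then $G$ is a lower bound block graph and $$rn(G)=mkh^2(n-1)+(m-1)(2h+1)+\varepsilon(G).$$ -/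

import Mathlib

namespace RadioBlock

universe u

/-! ### Radio labelings -/

section Radio

variable {V : Type u}

/-- A radio `k`-labeling of `G`: a map `f : V → {0, 1, 2, …}` such that
`|f u - f v| ≥ k + 1 - d(u, v)` for any two distinct vertices `u`, `v`. -/
def IsRadioLabeling (G : SimpleGraph V) (k : ℕ) (f : V → ℕ) : Prop :=
  ∀ u v : V, u ≠ v → (k : ℤ) + 1 - (G.dist u v : ℤ) ≤ |(f u : ℤ) - (f v : ℤ)|

/-- The span of a labeling: the maximum of `|f u - f v|` over all pairs of vertices. -/
def labelSpan [Fintype V] (f : V → ℕ) : ℕ :=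
  (Finset.univ : Finset (V × V)).sup fun p => ((f p.1 : ℤ) - (f p.2 : ℤ)).natAbs

/-- The radio-`k`-number: the minimum span of a radio `k`-labeling. -/
noncomputable def radioKNumber [Fintype V] (G : SimpleGraph V) (k : ℕ) : ℕ :=
  sInf {s : ℕ | ∃ f : V → ℕ, IsRadioLabeling G k f ∧ labelSpan f = s}

/-- The minimum defining the radio-`k`-number is taken over a nonempty set. -/
theorem radioKNumber_set_nonempty [Fintype V] (G : SimpleGraph V) (k : ℕ) :
    {s : ℕ | ∃ f : V → ℕ, IsRadioLabeling G k f ∧ labelSpan f = s}.Nonempty := by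
  refine ⟨_, fun v => (k + 1) * (Fintype.equivFin V v : ℕ), ?_, rfl⟩
  intro u v huv
  have hne : ((Fintype.equivFin V u : ℕ) : ℤ) - ((Fintype.equivFin V v : ℕ) : ℤ) ≠ 0 := by
    intro h
    apply huv
    apply (Fintype.equivFin V).injective
    apply Fin.ext
    omega
  have h1 := Int.one_le_abs hne
  push_cast
  rw [← mul_sub, abs_mul, abs_of_nonneg (by positivity : (0 : ℤ) ≤ (k : ℤ) + 1)]
  nlinarith [Int.natCast_nonneg (G.dist u v), Int.natCast_nonneg k]

/-- The radio number `rn(G)`: the radio-`d(G)`-number, `d(G)` being the diameter. -/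
noncomputable def radioNumber [Fintype V] (G : SimpleGraph V) : ℕ :=
  radioKNumber G G.diam

end Radio

/-! ### Block graphs -/

section Blocks

variable {V : Type u}

/-- A cut-vertex: a vertex whose deletion increases the number of components. -/
def IsCutVertex (G : SimpleGraph V) (v : V) : Prop :=
  Nat.card G.ConnectedComponent < Nat.card (G.induce ({v}ᶜ : Set V)).ConnectedComponent

/-- A connected graph without cut-vertices. -/
def HasNoCutVertex (G : SimpleGraph V) : Prop :=
  G.Connected ∧ ∀ v : V, ¬ IsCutVertex G v

/-- `B` is the vertex set of a block of `G`: a maximal connected induced subgraph that has no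
cut-vertex of its own. -/
def IsBlock (G : SimpleGraph V) (B : Set V) : Prop :=
  Maximal (fun S : Set V => HasNoCutVertex (G.induce S)) B

/-- A block graph: a connected graph all of whose blocks are cliques. -/
def IsBlockGraph (G : SimpleGraph V) : Prop :=
  G.Connected ∧ ∀ B : Set V, IsBlock G B → G.IsClique B

end Blocks

/-! ### Weight centers, levels, and the lower bound -/

section Levels

variable {V : Type u} [Fintype V]

/-- The weight of `G` at `v`. -/
noncomputable def weightAt (G : SimpleGraph V) (v : V) : ℕ :=
  ∑ u : V, G.dist u v

/-- The weight of `G`. -/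
noncomputable def weight (G : SimpleGraph V) : ℕ :=
  ⨅ v : V, weightAt G v

/-- The set `W(G)` of weight centers of `G`. -/
def weightCenters (G : SimpleGraph V) : Set V :=
  {v : V | weightAt G v = weight G}

/-- A central vertex of a block graph: the weight center if there is only one, and otherwise a
vertex of the central block, i.e. of the block that contains all the weight centers. -/
def IsCentralVertex (G : SimpleGraph V) (w : V) : Prop :=
  weightCenters G = {w} ∨
    ((weightCenters G).Nontrivial ∧ ∃ B : Set V, IsBlock G B ∧ weightCenters G ⊆ B ∧ w ∈ B)

/-- The level of a vertex: its distance to the nearest central vertex. -/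
noncomputable def level (G : SimpleGraph V) (v : V) : ℕ :=
  sInf {d : ℕ | ∃ w : V, IsCentralVertex G w ∧ G.dist v w = d}

/-- The total level `L(G)`. -/
noncomputable def totalLevel (G : SimpleGraph V) : ℕ :=
  ∑ v : V, level G v

open Classical in
/-- `ε(G)`: one if there is exactly one weight center, zero if there are at least two. -/
noncomputable def epsilon (G : SimpleGraph V) : ℕ :=
  if (weightCenters G).ncard = 1 then 1 else 0

/-- `LB(G) = (p - 1)(d(G) + ε(G)) - 2 L(G) + ε(G)`, where `p` is the order of `G`. -/
noncomputable def lowerBound (G : SimpleGraph V) : ℤ :=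
  ((Fintype.card V : ℤ) - 1) * ((G.diam : ℤ) + (epsilon G : ℤ)) - 2 * (totalLevel G : ℤ)
    + (epsilon G : ℤ)

/-- A lower bound block graph: a block graph with `rn(G) = LB(G)`. -/
def IsLowerBoundBlockGraph (G : SimpleGraph V) : Prop :=
  IsBlockGraph G ∧ (radioNumber G : ℤ) = lowerBound G

end Levels

/-! ### Paths of cliques and extended stars of blocks -/

/-- The vertices of the path of cliques `P_{h,n}`: the `h + 1` vertices of the path with `h`
edges, and `n - 2` additional vertices for each of these edges. -/
abbrev CliquePathVertex (h n : ℕ) : Type :=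
  Fin (h + 1) ⊕ (Fin h × Fin (n - 2))

/-- The vertex belongs to the clique of the edge `e`, whose end points are the path vertices
`e` and `e + 1`. -/
def InClique {h n : ℕ} (e : Fin h) : CliquePathVertex h n → Prop
  | Sum.inl i => i = e.castSucc ∨ i = e.succ
  | Sum.inr (e', _) => e' = e

/-- The path of cliques `P_{h,n}`. -/
def cliquePath (h n : ℕ) : SimpleGraph (CliquePathVertex h n) where
  Adj x y := x ≠ y ∧ ∃ e : Fin h, InClique e x ∧ InClique e y
  symm := ⟨fun _ _ hxy => ⟨hxy.1.symm, hxy.2.imp fun _ he => ⟨he.2, he.1⟩⟩⟩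
  loopless := ⟨fun _ hx => hx.1 rfl⟩

/-- A tail vertex of `P_{h,n}`: a vertex whose eccentricity equals the diameter. -/
def IsTailVertex {h n : ℕ} (t : CliquePathVertex h n) : Prop :=
  (cliquePath h n).eccent t = (cliquePath h n).ediam

/-- The vertices of the extended star of blocks: the clique `K_m`, and, for each vertex `a` of
`K_m` and each of its `k` copies of `P_{h,n}`, the vertices of that copy except the tail vertex
`t a c`, which is identified with `a`. -/
abbrev StarVertex (m k h n : ℕ) (t : Fin m → Fin k → CliquePathVertex h n) : Type :=
  Fin m ⊕ ((a : Fin m) × (c : Fin k) × {x : CliquePathVertex h n // x ≠ t a c})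

/-- Adjacency in the extended star of blocks. -/
def StarAdj {m k h n : ℕ} (t : Fin m → Fin k → CliquePathVertex h n) :
    StarVertex m k h n t → StarVertex m k h n t → Prop
  | Sum.inl a, Sum.inl b => a ≠ b
  | Sum.inl a, Sum.inr ⟨b, c, x⟩ => a = b ∧ (cliquePath h n).Adj (t b c) x.1
  | Sum.inr ⟨b, c, x⟩, Sum.inl a => a = b ∧ (cliquePath h n).Adj (t b c) x.1
  | Sum.inr ⟨a, c, x⟩, Sum.inr ⟨b, d, y⟩ => a = b ∧ c = d ∧ (cliquePath h n).Adj x.1 y.1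

/-- The extended star of blocks `S^m_{k,h,n}`, obtained from the clique `K_m` by attaching `k`
copies of `P_{h,n}` to each of its vertices; `t a c` is the vertex of the `c`-th copy at the
vertex `a` that is identified with `a`. -/
def extendedStar (m k h n : ℕ) (t : Fin m → Fin k → CliquePathVertex h n) :
    SimpleGraph (StarVertex m k h n t) where
  Adj := StarAdj t
  symm := ⟨by
    rintro (a | ⟨a, c, x⟩) (b | ⟨b, d, y⟩) hab
    · exact Ne.symm hab
    · exact hab
    · exact hab
    · exact ⟨hab.1.symm, hab.2.1.symm, hab.2.2.symm⟩⟩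
  loopless := ⟨by
    rintro (a | ⟨a, c, x⟩) haa
    · exact haa rfl
    · exact haa.2.2.ne rfl⟩

end RadioBlock

/-! Let `lev v` be the distance from `v` to the vertex of `K_m` (its root) at which its chain hangs,
and `N = n - 1` the number of vertices on each positive level of a chain. Then `d(u,v) ≤ lev u + lev
v + [roots differ]`, with equality unless `u` and `v` have positive level on a common chain. The
weight centers are exactly the roots, so `lev` is the level, and in every case `d(G) + ε(G) = 2h +
1`; call this number `D`.

Lower bound (`exists_span_ge`, `lowerBound_le_labelSpan`): the radio condition gives `|f u - f v| ≥
D - lev u - lev v`. Summed over neighbours in the order of the labels, this counts every level twice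
except those of the two ends, and these add up to at least `ε`, since a single root cannot be both
ends.

Upper bound (`label_add_diam_le`): it is enough to order the vertices so that every consecutive gap
can be exactly `D - lev u - lev v` and the end levels add up to `ε`. The order is one root, then
rounds that visit every chain once, then the other roots, with roots advancing cyclically.
Neighbouring chains in a round are traversed in opposite directions, so their levels add up to `h +
1`. Pairs one or two places apart on different chains are settled by the distance formula. Pairs at
least three apart are settled by `seqLevel_window`: the gap is at least `3D - (4h + 2) = 2h + 1 ≥
d(G)`, and the distance is at least 1. A chain recurs after two places only if `(m, k) = (2, 1)`,
where `N = 1` and `roundLevel_two` applies. -/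

namespace RadioBlock

/-! ### Paths of cliques seen from a tail vertex -/

/-- Coordinates on a graph made of a chain of `h` cliques hanging from `t`: `lev` is the distance
to `t`, and the vertices of one level are told apart by `idx`, which takes values below `N`. -/
structure IsChainProfile {W : Type*} (G : SimpleGraph W) (t : W) (h N : ℕ) (lev idx : W → ℕ) :
    Prop where
  lev_eq_zero : ∀ x, lev x = 0 ↔ x = t
  lev_le : ∀ x, lev x ≤ h
  idx_lt : ∀ x, idx x < N
  inj : ∀ x y, lev x = lev y → idx x = idx y → x = y
  lev_le_of_adj : ∀ x y, G.Adj x y → lev x ≤ lev y + 1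
  adj_of_lev_eq : ∀ x y, lev x = lev y → x ≠ y → G.Adj x y
  exists_down : ∀ x, 0 < lev x → ∃ y, G.Adj x y ∧ lev y + 1 = lev x
  down_unique : ∀ x y z w, lev x = lev y → G.Adj x z → G.Adj y w → lev z + 1 = lev x →
    lev w + 1 = lev y → z = w

theorem IsChainProfile.comp_iso {W W' : Type*} {G : SimpleGraph W} {G' : SimpleGraph W'}
    (φ : G ≃g G') {t : W} {h N : ℕ} {lev idx : W' → ℕ}
    (H : IsChainProfile G' (φ t) h N lev idx) :
    IsChainProfile G t h N (lev ∘ φ) (idx ∘ φ) where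
  lev_eq_zero x := by simp [H.lev_eq_zero]
  lev_le x := H.lev_le _
  idx_lt x := H.idx_lt _
  inj x y h1 h2 := φ.injective (H.inj _ _ h1 h2)
  lev_le_of_adj x y hxy := H.lev_le_of_adj _ _ (φ.map_adj_iff.2 hxy)
  adj_of_lev_eq x y h1 h2 := φ.map_adj_iff.1 (H.adj_of_lev_eq _ _ h1 (φ.injective.ne h2))
  exists_down x hx := by
    obtain ⟨y, h1, h2⟩ := H.exists_down _ hx
    refine ⟨φ.symm y, ?_, by simpa using h2⟩
    rw [← φ.map_adj_iff]
    simpa using h1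
  down_unique x y z w h1 h2 h3 h4 h5 := φ.injective
    (H.down_unique _ _ _ _ h1 (φ.map_adj_iff.2 h2) (φ.map_adj_iff.2 h3) h4 h5)

variable {h n : ℕ}

/-- The first path vertex of the cliques that contain the vertex, or the path vertex itself. -/
def cliqueLo : CliquePathVertex h n → ℕ
  | Sum.inl i => i
  | Sum.inr (e, _) => e

/-- The last path vertex of the cliques that contain the vertex, or the path vertex itself. -/
def cliqueHi : CliquePathVertex h n → ℕ
  | Sum.inl i => i
  | Sum.inr (e, _) => e + 1

theorem cliqueHi_le (x : CliquePathVertex h n) : cliqueHi x ≤ h := by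
  rcases x with i | ⟨e, j⟩
  · have := i.2; simp only [cliqueHi]; omega
  · have := e.2; simp only [cliqueHi]; omega

theorem cliqueLo_le_cliqueHi (x : CliquePathVertex h n) : cliqueLo x ≤ cliqueHi x := by
  rcases x with i | ⟨e, j⟩ <;> simp [cliqueLo, cliqueHi]

theorem exists_pathVertex {i : ℕ} (hi : i ≤ h) :
    ∃ y : CliquePathVertex h n, cliqueLo y = i ∧ cliqueHi y = i :=
  ⟨Sum.inl ⟨i, by omega⟩, rfl, rfl⟩

theorem inClique_iff (e : Fin h) (x : CliquePathVertex h n) :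
    InClique e x ↔ cliqueLo x ≤ cliqueHi x ∧ (e : ℕ) ≤ cliqueLo x ∧ cliqueHi x ≤ e + 1 := by
  rcases x with i | ⟨e', j⟩
  · simp only [InClique, cliqueLo, cliqueHi, Fin.ext_iff, Fin.val_castSucc, Fin.val_succ]
    omega
  · simp only [InClique, cliqueLo, cliqueHi, Fin.ext_iff]
    omega

/-- A vertex occupies the interval from `cliqueLo` to `cliqueHi`, of length at most 1; two vertices
share a clique when both intervals fit into one edge of the path. -/
theorem cliquePath_adj_iff (x y : CliquePathVertex h n) (hh : 0 < h) :
    (cliquePath h n).Adj x y ↔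
      x ≠ y ∧ cliqueHi x ≤ cliqueLo y + 1 ∧ cliqueHi y ≤ cliqueLo x + 1 := by
  have hx := cliqueLo_le_cliqueHi x
  have hy := cliqueLo_le_cliqueHi y
  have hx' := cliqueHi_le x
  have hy' := cliqueHi_le y
  simp only [cliquePath, inClique_iff]
  constructor
  · rintro ⟨h1, e, h2, h3⟩
    exact ⟨h1, by omega, by omega⟩
  · rintro ⟨h1, h2, h3⟩
    refine ⟨h1, ?_⟩
    -- The leftmost left end names the edge, except that the path vertex `h` lies only in the last
    -- clique.
    by_cases hc : cliqueLo x < h ∧ cliqueLo y < h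
    · refine ⟨⟨min (cliqueLo x) (cliqueLo y), by omega⟩, ?_, ?_⟩
      · have : cliqueHi x ≤ cliqueLo x + 1 := by
          rcases x with i | ⟨e, j⟩ <;> simp [cliqueLo, cliqueHi]
        simp only; omega
      · have : cliqueHi y ≤ cliqueLo y + 1 := by
          rcases y with i | ⟨e, j⟩ <;> simp [cliqueLo, cliqueHi]
        simp only; omega
    · refine ⟨⟨h - 1, by omega⟩, ?_, ?_⟩ <;> simp only <;> omega

/-- The reversal of a path of cliques. -/
def cliqueRev (h n : ℕ) : cliquePath h n ≃g cliquePath h n where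
  toEquiv := Equiv.sumCongr Fin.revPerm (Equiv.prodCongr Fin.revPerm (Equiv.refl _))
  map_rel_iff' := by
    have key : ∀ (e : Fin h) (x : CliquePathVertex h n), InClique e.rev
        (Equiv.sumCongr Fin.revPerm (Equiv.prodCongr Fin.revPerm (Equiv.refl _)) x) ↔
          InClique e x := by
      rintro e (i | ⟨e', j⟩)
      · simp only [Equiv.sumCongr_apply, Sum.map_inl, Fin.revPerm_apply, InClique,
          Fin.ext_iff, Fin.val_castSucc, Fin.val_succ, Fin.val_rev]
        omega
      · simp [InClique]
    intro x y
    simp only [cliquePath]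
    refine and_congr (Equiv.injective _).ne_iff ⟨?_, ?_⟩
    · rintro ⟨e, h1, h2⟩
      refine ⟨e.rev, ?_, ?_⟩
      · rw [← key]; simpa using h1
      · rw [← key]; simpa using h2
    · rintro ⟨e, h1, h2⟩
      exact ⟨e.rev, (key _ _).2 h1, (key _ _).2 h2⟩

theorem cliqueLo_cliqueRev (x : CliquePathVertex h n) :
    cliqueLo (cliqueRev h n x) = h - cliqueHi x := by
  rcases x with i | ⟨e, j⟩
  · show ((i.rev : Fin (h + 1)) : ℕ) = h - i
    simp [Fin.val_rev]
  · show ((e.rev : Fin h) : ℕ) = h - (e + 1)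
    simp [Fin.val_rev]

theorem edist_le_of_descent {W : Type*} {G : SimpleGraph W} {t : W} {g : W → ℕ}
    (h0 : ∀ x, g x = 0 → x = t) (hd : ∀ x, 0 < g x → ∃ y, G.Adj x y ∧ g y < g x) (x : W) :
    G.edist x t ≤ g x := by
  induction hg : g x using Nat.strong_induction_on generalizing x with
  | _ d ih =>
    rcases Nat.eq_zero_or_pos d with rfl | hpos
    · rw [h0 x hg]; simp
    · obtain ⟨y, h1, h2⟩ := hd x (by omega)
      calc G.edist x t ≤ G.edist x y + G.edist y t := SimpleGraph.edist_triangle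
        _ ≤ 1 + (g y : ℕ∞) := by
            gcongr
            · exact (SimpleGraph.edist_eq_one_iff_adj.2 h1).le
            · exact ih _ (by omega) y rfl
        _ ≤ d := by exact_mod_cast (by omega : 1 + g y ≤ d)

/-- Stepping through path vertices towards `t` lowers the bound at each step until `t` itself is
adjacent. -/
theorem edist_cliquePath_le (hh : 0 < h) (x t : CliquePathVertex h n) :
    (cliquePath h n).edist x t ≤ ((max (cliqueHi x - cliqueLo t) (cliqueHi t - cliqueLo x) : ℕ) : ℕ∞)
      := by
  classical
  by_cases hxt : x = t
  · subst hxt; simp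
  have key := edist_le_of_descent (G := cliquePath h n) (t := t)
    (g := fun x => if x = t then 0 else max (cliqueHi x - cliqueLo t) (cliqueHi t - cliqueLo x))
    ?_ ?_ x
  · simpa [hxt] using key
  · intro x hx
    by_contra hne
    simp only [hne, if_false] at hx
    rcases x with i | ⟨e, j⟩ <;> rcases t with i' | ⟨e', j'⟩ <;>
      simp only [cliqueHi, cliqueLo] at hx
    · exact hne (congrArg _ (Fin.ext (by omega)))
    all_goals omega
  · intro x hx
    by_cases hne : x = t
    · simp [hne] at hx
    by_cases hadj : (cliquePath h n).Adj x t
    · exact ⟨t, hadj, by simpa using hx⟩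
    rw [cliquePath_adj_iff _ _ hh] at hadj
    have hx1 := cliqueLo_le_cliqueHi x
    have ht1 := cliqueLo_le_cliqueHi t
    have hx2 := cliqueHi_le x
    have ht2 := cliqueHi_le t
    have hx3 : cliqueHi x ≤ cliqueLo x + 1 := by
      rcases x with i | ⟨e, j⟩ <;> simp [cliqueLo, cliqueHi]
    have ht3 : cliqueHi t ≤ cliqueLo t + 1 := by
      rcases t with i | ⟨e, j⟩ <;> simp [cliqueLo, cliqueHi]
    have hcase : cliqueLo t + 2 ≤ cliqueHi x ∨ cliqueLo x + 2 ≤ cliqueHi t := by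
      by_contra hcon
      exact hadj ⟨hne, by omega, by omega⟩
    rcases hcase with hc | hc
    · obtain ⟨y, hy1, hy2⟩ := exists_pathVertex (n := n) (i := cliqueHi x - 1) (h := h) (by omega)
      refine ⟨y, (cliquePath_adj_iff _ _ hh).2 ⟨?_, by omega, by omega⟩, ?_⟩
      · rintro rfl; omega
      · simp only [hne, if_false]
        split_ifs <;> omega
    · obtain ⟨y, hy1, hy2⟩ := exists_pathVertex (n := n) (i := cliqueLo x + 1) (h := h) (by omega)
      refine ⟨y, (cliquePath_adj_iff _ _ hh).2 ⟨?_, by omega, by omega⟩, ?_⟩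
      · rintro rfl; omega
      · simp only [hne, if_false]
        split_ifs <;> omega

/-- Lower bounds on distances come from a potential that drops by at most 1 along each edge. -/
theorem le_add_length_of_lipschitz {W : Type*} {G : SimpleGraph W} {g : W → ℤ}
    (hg : ∀ x y, G.Adj x y → g x ≤ g y + 1) {x y : W} (p : G.Walk x y) : g x ≤ g y + p.length := by
  induction p with
  | nil => simp
  | cons h p ih =>
    have := hg _ _ h
    simp only [SimpleGraph.Walk.length_cons]
    push_cast
    omega

/-- A vertex outside both end cliques is within `h - 1` of everything, whereas the two ends of the
path are at distance at least `h`. -/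
theorem IsTailVertex.lo_or_hi (hh : 0 < h) {t : CliquePathVertex h n} (ht : IsTailVertex t) :
    cliqueLo t = 0 ∨ cliqueHi t = h := by
  by_contra! hcon
  have h1 : (cliquePath h n).eccent t ≤ ((h - 1 : ℕ) : ℕ∞) := by
    rw [SimpleGraph.eccent]
    refine iSup_le fun x => (edist_cliquePath_le hh t x).trans ?_
    have := cliqueHi_le x
    have := cliqueHi_le t
    exact_mod_cast (by omega)
  have h2 : (h : ℕ∞) ≤ (cliquePath h n).edist (Sum.inl (Fin.last h)) (Sum.inl 0) := by
    rw [SimpleGraph.edist]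
    refine le_iInf fun p => ?_
    have := le_add_length_of_lipschitz (g := fun x => (cliqueHi x : ℤ)) (fun x y hxy => by
      rw [cliquePath_adj_iff _ _ hh] at hxy
      have := cliqueLo_le_cliqueHi y
      omega) p
    simp only [cliqueHi, Fin.val_last, Fin.val_zero] at this
    exact_mod_cast (by omega : h ≤ p.length)
  have h3 := h2.trans (SimpleGraph.edist_le_ediam)
  rw [← ht] at h3
  have : h ≤ h - 1 := by exact_mod_cast h3.trans h1
  omega

/-- The index of a vertex within its level, seen from the tail vertex `t` at the left end. -/
def leftIdx (t : CliquePathVertex h n) : CliquePathVertex h n → ℕ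
  -- If the tail is an added vertex, the end of the path moves to level 1 and takes over the index
  -- that the tail vacates. All other path vertices use `n - 2`, which no added vertex has.
  | Sum.inl i => if (i : ℕ) = 0 then (match t with
      | Sum.inl _ => 0
      | Sum.inr (_, j) => j) else n - 2
  | Sum.inr (_, j) => j

open Classical in
/-- The level of a vertex, seen from the tail vertex `t` at the left end. -/
noncomputable def leftLev (t x : CliquePathVertex h n) : ℕ :=
  -- The end of the path has `cliqueHi` equal to 0, yet it is one step away from any other tail of
  -- the same clique.
  if x = t then 0 else max 1 (cliqueHi x)

theorem isChainProfile_left (hh : 0 < h) (hn : 2 ≤ n) {t : CliquePathVertex h n}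
    (ht : cliqueLo t = 0) :
    IsChainProfile (cliquePath h n) t h (n - 1) (leftLev t) (leftIdx t) := by
  have ht' : cliqueHi t ≤ 1 := by
    rcases t with i | ⟨e, j⟩ <;> simp_all [cliqueLo, cliqueHi]
  have hself : leftLev t t = 0 := by simp [leftLev]
  have hne : ∀ x, x ≠ t → leftLev t x = max 1 (cliqueHi x) := fun x hx => by simp [leftLev, hx]
  have hz : ∀ x, leftLev t x = 0 ↔ x = t := fun x => by
    by_cases hx : x = t
    · simp [hx, hself]
    · rw [hne x hx]; simp [hx]
  have hle : ∀ x, leftLev t x ≤ max 1 (cliqueHi x) := fun x => by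
    by_cases hx : x = t
    · simp [hx, hself]
    · rw [hne x hx]
  have hlh : ∀ x : CliquePathVertex h n, cliqueHi x ≤ cliqueLo x + 1 := fun x => by
      rcases x with i | ⟨e, j⟩ <;> simp [cliqueLo, cliqueHi]
  refine ⟨hz, ?_, ?_, ?_, ?_, ?_, ?_, ?_⟩
  · intro x
    have := hle x
    have := cliqueHi_le x
    omega
  · rintro (i | ⟨e, j⟩)
    · simp only [leftIdx]
      split_ifs
      · rcases t with i' | ⟨e', j'⟩
        · simp only; omega
        · have := j'.2; simp only; omega
      · omega
    · have := j.2; simp only [leftIdx]; omega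
  · intro x y h1 h2
    by_cases hx : x = t
    · rw [hx, hself] at h1; rw [hx, (hz y).1 h1.symm]
    have hy : y ≠ t := fun hy => hx ((hz x).1 (by rw [h1, hy, hself]))
    rw [hne x hx, hne y hy] at h1
    rcases t with i0 | ⟨e0, j0⟩ <;> rcases x with i | ⟨e, j⟩ <;> rcases y with i' | ⟨e', j'⟩ <;>
      simp only [cliqueHi, cliqueLo, leftIdx, ne_eq, Sum.inl.injEq, Sum.inr.injEq, reduceCtorEq,
        not_false_eq_true, Fin.ext_iff, Prod.mk.injEq] at * <;>
      (try have := j.2) <;> (try have := j'.2) <;> (try have := j0.2) <;>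
      (try split_ifs at h2) <;> omega
  · intro x y hxy
    by_cases hx : x = t
    · rw [hx, hself]; omega
    rw [cliquePath_adj_iff _ _ hh] at hxy
    have := cliqueLo_le_cliqueHi y
    rw [hne x hx]
    by_cases hy : y = t
    · subst hy; rw [hself]; omega
    · rw [hne y hy]; omega
  · intro x y h1 h2
    by_cases hx : x = t
    · rw [hx, hself] at h1; exact absurd ((hz y).1 h1.symm) (fun h => h2 (by rw [hx, h]))
    have hy : y ≠ t := fun hy => hx ((hz x).1 (by rw [h1, hy, hself]))
    rw [hne x hx, hne y hy] at h1
    rw [cliquePath_adj_iff _ _ hh]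
    have := hlh x
    have := hlh y
    exact ⟨h2, by omega, by omega⟩
  · intro x hx
    have hxt : x ≠ t := fun h => by rw [h, hself] at hx; omega
    rw [hne x hxt]
    by_cases h1 : cliqueHi x ≤ 1
    · refine ⟨t, ?_, by rw [hself]; omega⟩
      rw [cliquePath_adj_iff _ _ hh]
      exact ⟨hxt, by omega, by omega⟩
    · have := cliqueHi_le x
      obtain ⟨y, hy1, hy2⟩ := exists_pathVertex (n := n) (i := cliqueHi x - 1) (h := h) (by omega)
      refine ⟨y, (cliquePath_adj_iff _ _ hh).2 ⟨?_, by omega, ?_⟩, ?_⟩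
      · rintro rfl; omega
      · have := hlh x
        omega
      · rw [hne]
        · omega
        · rintro rfl; omega
  · intro x y z w h1 h2 h3 h4 h5
    by_cases hz0 : leftLev t z = 0
    · rw [(hz z).1 hz0, (hz w).1 (by omega)]
    have hzt : z ≠ t := fun h => hz0 ((hz z).2 h)
    have hwt : w ≠ t := fun h => by have := (hz w).2 h; omega
    have hxt : x ≠ t := fun h => by have := (hz x).2 h; omega
    have hyt : y ≠ t := fun h => by have := (hz y).2 h; omega
    rw [hne x hxt, hne z hzt] at h4
    rw [hne y hyt, hne w hwt] at h5
    rw [hne x hxt, hne y hyt] at h1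
    rw [cliquePath_adj_iff _ _ hh] at h2 h3
    have hz1 := cliqueLo_le_cliqueHi z
    have hw1 := cliqueLo_le_cliqueHi w
    -- Below level 2 or higher, adjacency forces the lower neighbour to be a degenerate interval,
    -- that is, the path vertex shared by two cliques.
    have e1 : cliqueLo z = cliqueHi w ∧ cliqueHi z = cliqueHi w ∧ cliqueLo w = cliqueHi w := by
      omega
    rcases z with i | ⟨e, j⟩ <;> rcases w with i' | ⟨e', j'⟩ <;>
      simp only [cliqueHi, cliqueLo] at e1
    · exact congrArg _ (Fin.ext (by omega))
    all_goals omega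

/-- Seen from a tail vertex, a path of cliques is a chain of cliques. -/
theorem IsTailVertex.exists_isChainProfile (hh : 0 < h) (hn : 2 ≤ n) {t : CliquePathVertex h n}
    (ht : IsTailVertex t) :
    ∃ lev idx, IsChainProfile (cliquePath h n) t h (n - 1) lev idx := by
  rcases ht.lo_or_hi hh with h1 | h1
  · exact ⟨_, _, isChainProfile_left hh hn h1⟩
  · exact ⟨_, _, (isChainProfile_left hh hn (t := cliqueRev h n t) (by
      rw [cliqueLo_cliqueRev, h1, Nat.sub_self])).comp_iso⟩

/-! ### Coordinates on an extended star of blocks -/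

/-- Coordinates on an extended star of blocks with `m` roots, the vertices of level zero, and `k`
chains of `h` cliques at each root. The vertices of positive level of one chain that have the same
level are told apart by `idx`, which takes `N` values. -/
structure IsStarProfile {V : Type*} [Fintype V] (G : SimpleGraph V) (m k h N : ℕ)
    (root cop lev idx : V → ℕ) : Prop where
  root_lt : ∀ v, root v < m
  cop_lt : ∀ v, 0 < lev v → cop v < k
  lev_le : ∀ v, lev v ≤ h
  idx_lt : ∀ v, 0 < lev v → idx v < N
  inj_root : ∀ u v, lev u = 0 → lev v = 0 → root u = root v → u = v
  inj : ∀ u v, 0 < lev u → lev u = lev v → root u = root v → cop u = cop v → idx u = idx v → u = v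
  adj_roots : ∀ u v, lev u = 0 → lev v = 0 → u ≠ v → G.Adj u v
  adj_cases : ∀ u v, G.Adj u v → (lev u = 0 ∧ lev v = 0) ∨
    (root u = root v ∧ (lev u = 0 ∨ lev v = 0 ∨ cop u = cop v) ∧ lev u ≤ lev v + 1 ∧
      lev v ≤ lev u + 1)
  adj_of_lev_eq : ∀ u v, 0 < lev u → lev u = lev v → root u = root v → cop u = cop v → u ≠ v →
    G.Adj u v
  exists_down : ∀ v, 0 < lev v → ∃ z, G.Adj v z ∧ lev z + 1 = lev v
  down_unique : ∀ x y z w, 0 < lev x → lev x = lev y → root x = root y → cop x = cop y →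
    G.Adj x z → G.Adj y w → lev z + 1 = lev x → lev w + 1 = lev y → z = w
  card_eq : Fintype.card V = m + m * k * (h * N)

variable {m k h n : ℕ}

theorem card_starVertex (hh : 0 < h) (hn : 2 ≤ n) (t : Fin m → Fin k → CliquePathVertex h n) :
    Fintype.card (StarVertex m k h n t) = m + m * k * (h * (n - 1)) := by
  classical
  have h1 : ∀ a c, Fintype.card {x : CliquePathVertex h n // x ≠ t a c} = h * (n - 1) := by
    intro a c
    rw [Fintype.card_subtype_compl, Fintype.card_subtype_eq]
    simp only [Fintype.card_sum, Fintype.card_fin, Fintype.card_prod]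
    obtain ⟨n, rfl⟩ := Nat.exists_eq_add_of_le hn
    simp only [Nat.add_sub_cancel_left, (by omega : 2 + n - 1 = n + 1)]
    rw [Nat.mul_add, Nat.mul_one]
    omega
  simp only [Fintype.card_sum, Fintype.card_fin, Fintype.card_sigma, h1, Finset.sum_const,
    Finset.card_univ, smul_eq_mul, mul_assoc]

/-- The coordinates of a vertex of an extended star: its root, the copy of the path of cliques,
its level and its index, the last two read off from those on the copies. -/
def starCoord {t : Fin m → Fin k → CliquePathVertex h n}
    (lev idx : Fin m → Fin k → CliquePathVertex h n → ℕ) :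
    StarVertex m k h n t → ℕ × ℕ × ℕ × ℕ
  | Sum.inl a => (a, 0, 0, 0)
  | Sum.inr ⟨a, c, x⟩ => (a, c, lev a c x.1, idx a c x.1)

theorem exists_isStarProfile (hh : 0 < h) (hn : 2 ≤ n)
    (t : Fin m → Fin k → CliquePathVertex h n) (ht : ∀ a c, IsTailVertex (t a c)) :
    ∃ root cop lev idx : StarVertex m k h n t → ℕ,
      IsStarProfile (extendedStar m k h n t) m k h (n - 1) root cop lev idx := by
  choose lev idx H using fun a c => (ht a c).exists_isChainProfile hh hn
  have hpos : ∀ a c (x : {x : CliquePathVertex h n // x ≠ t a c}), 0 < lev a c x.1 :=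
    fun a c x => Nat.pos_of_ne_zero fun h => x.2 (((H a c).lev_eq_zero _).1 h)
  have ht0 : ∀ a c, lev a c (t a c) = 0 := fun a c => ((H a c).lev_eq_zero _).2 rfl
  have hadj1 : ∀ a c x, (cliquePath h n).Adj (t a c) x → lev a c x ≤ 1 := fun a c x hx => by
    have := (H a c).lev_le_of_adj _ _ hx.symm
    rwa [ht0] at this
  refine ⟨fun v => (starCoord lev idx v).1, fun v => (starCoord lev idx v).2.1,
    fun v => (starCoord lev idx v).2.2.1, fun v => (starCoord lev idx v).2.2.2, ?_⟩
  refine ⟨?_, ?_, ?_, ?_, ?_, ?_, ?_, ?_, ?_, ?_, ?_, card_starVertex hh hn t⟩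
  · rintro (a | ⟨a, c, x⟩)
    exacts [a.2, a.2]
  · rintro (a | ⟨a, c, x⟩) h0
    exacts [absurd h0 (lt_irrefl 0), c.2]
  · rintro (a | ⟨a, c, x⟩)
    exacts [Nat.zero_le _, (H a c).lev_le _]
  · rintro (a | ⟨a, c, x⟩) h0
    exacts [absurd h0 (lt_irrefl 0), (H a c).idx_lt _]
  · rintro (a | ⟨a, c, x⟩) (b | ⟨b, d, y⟩) h1 h2 h3
    · exact congrArg _ (Fin.ext h3)
    · exact absurd h2 (hpos b d y).ne'
    · exact absurd h1 (hpos a c x).ne'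
    · exact absurd h2 (hpos b d y).ne'
  · rintro (a | ⟨a, c, x⟩) (b | ⟨b, d, y⟩) h0 h1 h2 h3 h4
    · exact absurd h0 (lt_irrefl 0)
    · exact absurd h0 (lt_irrefl 0)
    · exact absurd h1 (hpos a c x).ne'
    · obtain rfl : a = b := Fin.ext h2
      obtain rfl : c = d := Fin.ext h3
      obtain rfl : x = y := Subtype.ext ((H a c).inj _ _ h1 h4)
      rfl
  · rintro (a | ⟨a, c, x⟩) (b | ⟨b, d, y⟩) h1 h2 h3
    · exact fun hab : a = b => h3 (congrArg _ hab)
    · exact absurd h2 (hpos b d y).ne'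
    · exact absurd h1 (hpos a c x).ne'
    · exact absurd h2 (hpos b d y).ne'
  · rintro (a | ⟨a, c, x⟩) (b | ⟨b, d, y⟩) hadj
    · exact Or.inl ⟨rfl, rfl⟩
    · obtain ⟨rfl, h2⟩ := hadj
      exact Or.inr ⟨rfl, Or.inl rfl, Nat.zero_le _, hadj1 _ _ _ h2⟩
    · obtain ⟨rfl, h2⟩ := hadj
      exact Or.inr ⟨rfl, Or.inr (Or.inl rfl), hadj1 _ _ _ h2, Nat.zero_le _⟩
    · obtain ⟨rfl, rfl, h2⟩ := hadj
      exact Or.inr ⟨rfl, Or.inr (Or.inr rfl), (H _ _).lev_le_of_adj _ _ h2,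
        (H _ _).lev_le_of_adj _ _ h2.symm⟩
  · rintro (a | ⟨a, c, x⟩) (b | ⟨b, d, y⟩) h0 h1 h2 h3 h4
    · exact absurd h0 (lt_irrefl 0)
    · exact absurd h0 (lt_irrefl 0)
    · exact absurd h1 (hpos a c x).ne'
    · obtain rfl : a = b := Fin.ext h2
      obtain rfl : c = d := Fin.ext h3
      exact ⟨rfl, rfl, (H a c).adj_of_lev_eq _ _ h1 fun h => h4 (by rw [Subtype.ext h])⟩
  · rintro (a | ⟨a, c, x⟩) h0
    · exact absurd h0 (lt_irrefl 0)
    · obtain ⟨y, h1, h2⟩ := (H a c).exists_down _ (hpos a c x)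
      by_cases hy : y = t a c
      · subst hy
        exact ⟨Sum.inl a, ⟨rfl, h1.symm⟩, by rw [ht0] at h2; exact h2⟩
      · exact ⟨Sum.inr ⟨a, c, ⟨y, hy⟩⟩, ⟨rfl, rfl, h1⟩, h2⟩
  · rintro (a | ⟨a, c, x⟩) (b | ⟨b, d, y⟩) z w h0 h1 h2 h3 h4 h5 h6 h7
    · exact absurd h0 (lt_irrefl 0)
    · exact absurd h0 (lt_irrefl 0)
    · exact absurd h1 (hpos a c x).ne'
    · obtain rfl : a = b := Fin.ext h2
      obtain rfl : c = d := Fin.ext h3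
      have hu := fun z w => (H a c).down_unique x.1 y.1 z w h1
      rcases z with b | ⟨b, d, z⟩ <;> rcases w with b' | ⟨b', d', w⟩
      · exact congrArg Sum.inl (h4.1.trans h5.1.symm)
      · obtain ⟨rfl, rfl, h5⟩ := h5
        obtain ⟨rfl, h4⟩ := h4
        exact absurd (hu _ _ h4.symm h5 (by rw [ht0]; exact h6) h7).symm w.2
      · obtain ⟨rfl, rfl, h4⟩ := h4
        obtain ⟨rfl, h5⟩ := h5
        exact absurd (hu _ _ h4 h5.symm h6 (by rw [ht0]; exact h7)) z.2
      · obtain ⟨rfl, rfl, h4⟩ := h4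
        obtain ⟨rfl, rfl, h5⟩ := h5
        rw [Subtype.ext (hu _ _ h4 h5 h6 h7)]

/-! ### Cut-vertices from separations -/

/-- A walk avoiding `z` that leaves `A` would have to leave it through `z`. -/
theorem isCutVertex_of_separation {W : Type*} [Finite W] {G : SimpleGraph W} (hG : G.Connected)
    {A : Set W} {z u v : W} (hu : u ∈ A) (hv : v ∉ A) (hz : z ∉ A) (hvz : v ≠ z)
    (hA : ∀ x ∈ A, ∀ y ∉ A, G.Adj x y → y = z) : IsCutVertex G z := by
  have h1 : Nat.card G.ConnectedComponent ≤ 1 := by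
    have := hG.preconnected.subsingleton_connectedComponent
    exact Finite.card_le_one_iff_subsingleton.2 this
  have huz : u ≠ z := fun h => hz (h ▸ hu)
  refine lt_of_le_of_lt h1 (Finite.one_lt_card_iff_nontrivial.2 ?_)
  refine ⟨(G.induce ({z}ᶜ : Set W)).connectedComponentMk ⟨u, huz⟩,
    (G.induce ({z}ᶜ : Set W)).connectedComponentMk ⟨v, hvz⟩, fun heq => ?_⟩
  obtain ⟨p⟩ := SimpleGraph.ConnectedComponent.exact heq
  obtain ⟨d, -, h2, h3⟩ := p.exists_boundary_dart (Subtype.val ⁻¹' A) hu hv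
  exact d.snd.2 (hA _ h2 _ h3 d.adj)

/-- If any two distinct nonadjacent vertices can be separated by one vertex, then the vertex sets of
the connected induced subgraphs without cut-vertices are cliques. -/
theorem isClique_of_hasNoCutVertex {V : Type*} [Finite V] {G : SimpleGraph V}
    (hsep : ∀ u v, u ≠ v → ¬ G.Adj u v → ∃ (A : Set V) (z : V), z ∉ A ∧ z ≠ u ∧ z ≠ v ∧
      ((u ∈ A ∧ v ∉ A) ∨ (v ∈ A ∧ u ∉ A)) ∧ ∀ x ∈ A, ∀ y ∉ A, G.Adj x y → y = z)
    {S : Set V} (hS : HasNoCutVertex (G.induce S)) : G.IsClique S := by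
  have key : ∀ u ∈ S, ∀ v ∈ S, ∀ (A : Set V) (z : V), z ∉ A → z ≠ v → u ∈ A → v ∉ A →
      (∀ x ∈ A, ∀ y ∉ A, G.Adj x y → y = z) → False := by
    intro u hu v hv A z hz hzv huA hvA hA
    obtain ⟨p⟩ := hS.1.preconnected ⟨u, hu⟩ ⟨v, hv⟩
    obtain ⟨d, -, h2, h3⟩ := p.exists_boundary_dart (Subtype.val ⁻¹' A) huA hvA
    -- A walk inside `S` from `u` to `v` must use the separating vertex, which therefore belongs to
    -- `S` and is a cut-vertex there.
    have hzS : z ∈ S := hA _ h2 _ h3 d.adj ▸ d.snd.2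
    refine hS.2 ⟨z, hzS⟩ (isCutVertex_of_separation hS.1 (A := Subtype.val ⁻¹' A)
      (u := ⟨u, hu⟩) (v := ⟨v, hv⟩) huA hvA hz (fun h => hzv (congrArg Subtype.val h).symm) ?_)
    exact fun x hx y hy hxy => Subtype.ext (hA _ hx _ hy hxy)
  intro u hu v hv huv
  by_contra hadj
  obtain ⟨A, z, h1, h2, h3, h4 | h4, h5⟩ := hsep u v huv hadj
  · exact key u hu v hv A z h1 h3 h4.1 h4.2 h5
  · exact key v hv u hu A z h1 h2 h4.1 h4.2 h5

theorem hasNoCutVertex_induce_of_isClique {V : Type*} [Finite V] {G : SimpleGraph V} {S : Set V}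
    (hne : S.Nonempty) (hS : G.IsClique S) : HasNoCutVertex (G.induce S) := by
  have htop : G.induce S = ⊤ := SimpleGraph.induce_eq_top.2 hS
  have := hne.to_subtype
  have hc : (G.induce S).Connected := by rw [htop]; exact SimpleGraph.connected_top
  refine ⟨hc, fun v hv => ?_⟩
  rw [IsCutVertex] at hv
  have h1 : 0 < Nat.card (G.induce S).ConnectedComponent := by
    have : Nonempty (G.induce S).ConnectedComponent :=
      ⟨(G.induce S).connectedComponentMk ⟨_, hne.some_mem⟩⟩
    exact Nat.card_pos
  have h2 : Nat.card ((G.induce S).induce ({v}ᶜ : Set S)).ConnectedComponent ≤ 1 := by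
    refine Finite.card_le_one_iff_subsingleton.2
      (SimpleGraph.Preconnected.subsingleton_connectedComponent ?_)
    rw [htop]
    intro x y
    by_cases hxy : x = y
    · rw [hxy]
    · exact SimpleGraph.Adj.reachable
        (show (⊤ : SimpleGraph S).Adj x y from fun h => hxy (Subtype.ext h))
  omega

namespace IsStarProfile

variable {V : Type*} [Fintype V] {G : SimpleGraph V} {m k h N : ℕ} {root cop lev idx : V → ℕ}

/-! ### Distances -/

/-- Two vertices of positive level on the same chain. -/
def SameChain (root cop lev : V → ℕ) (u v : V) : Prop :=
  0 < lev u ∧ 0 < lev v ∧ root u = root v ∧ cop u = cop v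

theorem exists_walk_root (H : IsStarProfile G m k h N root cop lev idx) (v : V) :
    ∃ r, lev r = 0 ∧ root r = root v ∧ ∃ p : G.Walk v r, p.length = lev v := by
  induction hl : lev v generalizing v with
  | zero => exact ⟨v, hl, rfl, SimpleGraph.Walk.nil, rfl⟩
  | succ l ih =>
    obtain ⟨z, h1, h2⟩ := H.exists_down v (by omega)
    obtain ⟨r, h3, h4, p, h5⟩ := ih z (by omega)
    refine ⟨r, h3, ?_, SimpleGraph.Walk.cons h1 p, by simp [h5]⟩
    have := H.adj_cases _ _ h1
    omega

theorem exists_walk (H : IsStarProfile G m k h N root cop lev idx) (u v : V) :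
    ∃ p : G.Walk u v, p.length ≤ lev u + lev v + if root u = root v then 0 else 1 := by
  obtain ⟨r, h1, h2, p, hp⟩ := H.exists_walk_root u
  obtain ⟨s, h3, h4, q, hq⟩ := H.exists_walk_root v
  by_cases hrs : r = s
  · subst hrs
    refine ⟨p.append q.reverse, ?_⟩
    simp only [SimpleGraph.Walk.length_append, SimpleGraph.Walk.length_reverse]
    omega
  · have hne : root u ≠ root v := fun h => hrs (H.inj_root _ _ h1 h3 (by omega))
    refine ⟨p.append (SimpleGraph.Walk.cons (H.adj_roots _ _ h1 h3 hrs) q.reverse), ?_⟩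
    simp only [SimpleGraph.Walk.length_append, SimpleGraph.Walk.length_cons,
      SimpleGraph.Walk.length_reverse, hne, if_false]
    omega

theorem dist_le (H : IsStarProfile G m k h N root cop lev idx) (u v : V) :
    G.dist u v ≤ lev u + lev v + if root u = root v then 0 else 1 := by
  obtain ⟨p, hp⟩ := H.exists_walk u v
  exact (SimpleGraph.dist_le p).trans hp

theorem preconnected (H : IsStarProfile G m k h N root cop lev idx) : G.Preconnected :=
  fun u v => ⟨(H.exists_walk u v).choose⟩

/-- The potential is the height on the chain of `u` and minus the distance to the root of `u`
elsewhere. It changes by at most 1 along an edge and falls from `lev u` to minus the remaining part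
of the claimed length. -/
theorem le_dist (H : IsStarProfile G m k h N root cop lev idx) {u v : V}
    (huv : ¬ SameChain root cop lev u v) :
    lev u + lev v + (if root u = root v then 0 else 1) ≤ G.dist u v := by
  classical
  obtain ⟨p, hp⟩ := (H.preconnected u v).exists_walk_length_eq_dist
  have key := le_add_length_of_lipschitz (G := G) (g := fun x =>
    if SameChain root cop lev u x then (lev x : ℤ)
    else -((lev x : ℤ) + if root u = root x then 0 else 1)) ?_ p
  · rw [hp, if_neg huv] at key
    have h1 : (if SameChain root cop lev u u then (lev u : ℤ)
        else -((lev u : ℤ) + if root u = root u then 0 else 1)) = lev u := by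
      rcases Nat.eq_zero_or_pos (lev u) with h | h <;> simp [SameChain, h]
    rw [h1] at key
    by_cases hr : root u = root v
    · simp only [hr, if_true] at key ⊢
      omega
    · simp only [hr, if_false] at key ⊢
      omega
  · intro x y hxy
    have := H.adj_cases x y hxy
    simp only [SameChain]
    split_ifs <;> omega

theorem dist_eq (H : IsStarProfile G m k h N root cop lev idx) {u v : V}
    (huv : ¬ SameChain root cop lev u v) :
    G.dist u v = lev u + lev v + if root u = root v then 0 else 1 :=
  le_antisymm (H.dist_le u v) (H.le_dist huv)

/-! ### Counting -/

-- The coordinates are injective, and the order of the graph equals the number of admissible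
-- coordinates; hence they are a bijection, and sums over vertices become sums over coordinates.
open Classical in
theorem sum_eq (H : IsStarProfile G m k h N root cop lev idx) (ψ : ℕ → ℕ) (φ : ℕ → ℕ → ℕ → ℕ) :
    ∑ v, (if lev v = 0 then ψ (root v) else φ (root v) (cop v) (lev v)) =
      ∑ a ∈ Finset.range m, ψ a +
        ∑ a ∈ Finset.range m, ∑ c ∈ Finset.range k, ∑ l ∈ Finset.range h, N * φ a c (l + 1) := by
  let F : V → Fin m ⊕ (Fin m × Fin k × Fin h × Fin N) := fun v =>
    if hv : lev v = 0 then Sum.inl ⟨root v, H.root_lt v⟩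
    else Sum.inr (⟨root v, H.root_lt v⟩, ⟨cop v, H.cop_lt v (by omega)⟩,
      ⟨lev v - 1, by have := H.lev_le v; omega⟩, ⟨idx v, H.idx_lt v (by omega)⟩)
  have hF : Function.Bijective F := by
    rw [Fintype.bijective_iff_injective_and_card]
    constructor
    · intro u v huv
      simp only [F] at huv
      split_ifs at huv with h1 h2 h2
      · simp only [Sum.inl.injEq, Fin.mk.injEq] at huv
        exact H.inj_root _ _ h1 h2 huv
      · simp only [Sum.inr.injEq, Prod.mk.injEq, Fin.mk.injEq] at huv
        exact H.inj _ _ (by omega) (by omega) huv.1 huv.2.1 huv.2.2.2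
    · rw [H.card_eq]
      simp only [Fintype.card_sum, Fintype.card_fin, Fintype.card_prod]
      ring
  rw [Fintype.sum_bijective F hF _ (Sum.elim (fun a => ψ a) (fun x => φ x.1 x.2.1 (x.2.2.1 + 1)))]
  · simp only [Fintype.sum_sum_type, Sum.elim_inl, Sum.elim_inr, Fintype.sum_prod_type,
      Finset.sum_const, Finset.card_univ, Fintype.card_fin, smul_eq_mul, Finset.sum_range]
  · intro v
    simp only [F]
    split_ifs with hv
    · rfl
    · simp only [Sum.elim_inr, (by omega : lev v - 1 + 1 = lev v)]

theorem sum_lev (H : IsStarProfile G m k h N root cop lev idx) :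
    2 * ∑ v, lev v = m * k * N * (h * (h + 1)) := by
  have := H.sum_eq (fun _ => 0) (fun _ _ l => l)
  have h2 : ∀ v, (if lev v = 0 then 0 else lev v) = lev v := fun v => by split_ifs <;> omega
  simp only [h2, Finset.sum_const_zero, zero_add, Finset.sum_const, Finset.card_range,
    smul_eq_mul, ← Finset.mul_sum] at this
  have h3 := Finset.sum_range_id_mul_two (h + 1)
  rw [Finset.sum_range_succ'] at h3
  rw [this]
  simp only [add_zero, Nat.add_sub_cancel] at h3
  linear_combination m * k * N * h3

theorem sum_root_ne (H : IsStarProfile G m k h N root cop lev idx) {a : ℕ} (ha : a < m) :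
    ∑ v, (if root v = a then 0 else 1) = (m - 1) * (1 + k * (h * N)) := by
  classical
  have := H.sum_eq (fun b => if b = a then 0 else 1) (fun b _ _ => if b = a then 0 else 1)
  simp only [ite_self] at this
  rw [this]
  have h1 : ∀ c, ∑ b ∈ Finset.range m, (if b = a then 0 else c) = (m - 1) * c := by
    intro c
    rw [← Finset.add_sum_erase _ _ (Finset.mem_range.2 ha), if_pos rfl, zero_add,
      Finset.sum_congr rfl (fun b hb => if_neg (Finset.ne_of_mem_erase hb)), Finset.sum_const,
      Finset.card_erase_of_mem (Finset.mem_range.2 ha), Finset.card_range, smul_eq_mul]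
  simp only [Finset.sum_const, Finset.card_range, smul_eq_mul, mul_ite, mul_one, mul_zero]
  rw [h1, h1]
  ring

open Classical in
theorem card_sameChain_le (H : IsStarProfile G m k h N root cop lev idx) (v : V) :
    (Finset.univ.filter fun u => SameChain root cop lev u v).card ≤ h * N := by
  rw [show h * N = (Finset.range h ×ˢ Finset.range N).card by simp]
  refine Finset.card_le_card_of_injOn (fun u => (lev u - 1, idx u)) ?_ ?_
  · intro u hu
    obtain ⟨-, hu⟩ := Finset.mem_filter.1 (Finset.mem_coe.1 hu)
    rw [SameChain] at hu
    have h1 := H.lev_le u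
    have h2 := H.idx_lt u hu.1
    simp only [Finset.coe_product, Finset.coe_range, Set.mem_prod, Set.mem_Iio]
    omega
  · intro x hx y hy hxy
    obtain ⟨-, hx⟩ := Finset.mem_filter.1 (Finset.mem_coe.1 hx)
    obtain ⟨-, hy⟩ := Finset.mem_filter.1 (Finset.mem_coe.1 hy)
    rw [SameChain] at hx hy
    simp only [Prod.mk.injEq] at hxy
    exact H.inj _ _ hx.1 (by omega) (by omega) (by omega) hxy.2

theorem exists_root (H : IsStarProfile G m k h N root cop lev idx) {a : ℕ} (ha : a < m) :
    ∃ v, lev v = 0 ∧ root v = a := by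
  classical
  by_contra! hcon
  -- If `a` were missed, the indicator of the roots with coordinate `a` would sum to 0 over the
  -- vertices but to 1 over the coordinates.
  have := H.sum_eq (fun b => if b = a then 1 else 0) (fun _ _ _ => 0)
  rw [Finset.sum_eq_zero] at this
  · simp [ha] at this
  · intro v _
    split_ifs with h1 h2
    · exact absurd h2 (hcon v h1)
    all_goals rfl

theorem exists_vertex (H : IsStarProfile G m k h N root cop lev idx) (hN : 0 < N) {a c l : ℕ}
    (ha : a < m) (hc : c < k) (hl : 0 < l) (hl' : l ≤ h) :
    ∃ v, lev v = l ∧ root v = a ∧ cop v = c := by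
  classical
  by_contra! hcon
  have := H.sum_eq (fun _ => 0) (fun b d l' => if b = a ∧ d = c ∧ l' = l then 1 else 0)
  rw [Finset.sum_eq_zero] at this
  · simp only [Finset.sum_const_zero, zero_add] at this
    have h1 := Finset.sum_eq_zero_iff.1 this.symm a (Finset.mem_range.2 ha)
    have h2 := Finset.sum_eq_zero_iff.1 h1 c (Finset.mem_range.2 hc)
    have h3 := Finset.sum_eq_zero_iff.1 h2 (l - 1) (Finset.mem_range.2 (by omega))
    simp [(by omega : l - 1 + 1 = l)] at h3
    omega
  · intro v _
    split_ifs with h1 h2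
    · rfl
    · exact absurd h2.2.1 (hcon v h2.2.2 h2.1)
    · rfl

/-! ### Diameter -/

theorem connected (H : IsStarProfile G m k h N root cop lev idx) (hm : 0 < m) : G.Connected :=
  haveI : Nonempty V := ⟨(H.exists_root hm).choose⟩
  ⟨H.preconnected⟩

theorem diam_eq (H : IsStarProfile G m k h N root cop lev idx) (hm : 0 < m) (hk : 0 < k)
    (hh : 0 < h) (hN : 0 < N) (hmk : 2 ≤ m * k) :
    G.diam = 2 * h + if m = 1 then 0 else 1 := by
  have hc := H.connected hm
  have := hc.nonempty
  apply le_antisymm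
  · obtain ⟨u, v, huv⟩ := G.exists_dist_eq_diam
    rw [← huv]
    have h1 := H.dist_le u v
    have h2 := H.lev_le u
    have h3 := H.lev_le v
    have h4 := H.root_lt u
    have h5 := H.root_lt v
    split_ifs at h1 ⊢ <;> omega
  -- A chain other than `(0, 0)`: at another root if there is one, otherwise a second copy at the
  -- same root. The deepest vertices of the two chains realise the diameter.
  · have hne : ∃ a c, a < m ∧ c < k ∧ (a, c) ≠ (0, 0) ∧ (m ≠ 1 → a ≠ 0) := by
      by_cases h1 : m = 1
      · subst h1
        exact ⟨0, 1, by omega, by omega, by simp, by simp⟩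
      · exact ⟨1, 0, by omega, by omega, by simp, by simp⟩
    obtain ⟨a, c, ha, hc', hac, ham⟩ := hne
    obtain ⟨u, h1, h2, h3⟩ := H.exists_vertex hN ha hc' hh le_rfl
    obtain ⟨v, h4, h5, h6⟩ := H.exists_vertex hN hm hk hh le_rfl
    have h7 : ¬ SameChain root cop lev u v := by
      rintro ⟨-, -, h8, h9⟩
      exact hac (by rw [← h2, ← h3, h8, h9, h5, h6])
    have h8 := H.dist_eq h7
    have h9 := G.dist_le_diam (SimpleGraph.connected_iff_ediam_ne_top.1 hc) (u := u) (v := v)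
    refine le_trans ?_ h9
    rw [h8]
    split_ifs <;> omega

/-! ### Blocks -/

/-- Take `u` to be the higher vertex. The part of its chain at or above its level meets the rest of
the graph only in the common lower neighbour `z`. -/
theorem exists_separation (H : IsStarProfile G m k h N root cop lev idx) (u v : V) (huv : u ≠ v)
    (hadj : ¬ G.Adj u v) : ∃ (A : Set V) (z : V), z ∉ A ∧ z ≠ u ∧ z ≠ v ∧
      ((u ∈ A ∧ v ∉ A) ∨ (v ∈ A ∧ u ∉ A)) ∧ ∀ x ∈ A, ∀ y ∉ A, G.Adj x y → y = z := by
  wlog hlev : lev v ≤ lev u generalizing u v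
  · obtain ⟨A, z, h1, h2, h3, h4, h5⟩ := this v u huv.symm (fun h => hadj h.symm) (by omega)
    exact ⟨A, z, h1, h3, h2, h4.symm, h5⟩
  have hu : 0 < lev u := by
    by_contra h0
    exact hadj (H.adj_roots u v (by omega) (by omega) huv)
  obtain ⟨z, h1, h2⟩ := H.exists_down u hu
  refine ⟨{x | lev u ≤ lev x ∧ root x = root u ∧ cop x = cop u}, z, ?_, ?_, ?_,
    Or.inl ⟨⟨le_rfl, rfl, rfl⟩, ?_⟩, ?_⟩
  · simp only [Set.mem_ofPred_eq]; omega
  · rintro rfl; omega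
  · rintro rfl; exact hadj h1
  · rintro ⟨h3, h4, h5⟩
    exact hadj (H.adj_of_lev_eq u v hu (by omega) h4.symm h5.symm huv)
  · rintro x ⟨h3, h4, h5⟩ y hy hxy
    have h6 := H.adj_cases x y hxy
    have h7 : lev x = lev u ∧ lev y + 1 = lev u := by
      simp only [Set.mem_ofPred_eq] at hy
      omega
    exact H.down_unique x u y z (by omega) h7.1 h4 h5 hxy h1 (by omega) h2

theorem isClique_of_hasNoCutVertex (H : IsStarProfile G m k h N root cop lev idx) {S : Set V}
    (hS : HasNoCutVertex (G.induce S)) : G.IsClique S :=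
  RadioBlock.isClique_of_hasNoCutVertex H.exists_separation hS

theorem isBlockGraph (H : IsStarProfile G m k h N root cop lev idx) (hm : 0 < m) :
    IsBlockGraph G :=
  ⟨H.connected hm, fun _ hB => H.isClique_of_hasNoCutVertex hB.prop⟩

theorem isClique_roots (H : IsStarProfile G m k h N root cop lev idx) :
    G.IsClique {v | lev v = 0} :=
  fun _ hu _ hv huv => H.adj_roots _ _ hu hv huv

/-- A vertex of positive level is adjacent to no root but its own, so it cannot extend a clique that
contains two roots. -/
theorem eq_roots_of_isClique (H : IsStarProfile G m k h N root cop lev idx) (hm : 2 ≤ m)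
    {S : Set V} (hS : G.IsClique S) (hsub : {v | lev v = 0} ⊆ S) : S = {v | lev v = 0} := by
  refine Set.Subset.antisymm (fun v hv => ?_) hsub
  by_contra hl
  obtain ⟨r, h1, h2⟩ := H.exists_root (a := 0) (by omega)
  obtain ⟨s, h3, h4⟩ := H.exists_root (a := 1) (by omega)
  simp only [Set.mem_ofPred_eq] at hl
  have h5 := H.adj_cases _ _ (hS hv (hsub h1) (by rintro rfl; exact hl h1))
  have h6 := H.adj_cases _ _ (hS hv (hsub h3) (by rintro rfl; exact hl h3))
  omega

theorem isBlock_roots (H : IsStarProfile G m k h N root cop lev idx) (hm : 2 ≤ m) :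
    IsBlock G {v | lev v = 0} := by
  refine ⟨hasNoCutVertex_induce_of_isClique ?_ H.isClique_roots, fun S hS hsub => ?_⟩
  · obtain ⟨r, h1, -⟩ := H.exists_root (a := 0) (by omega)
    exact ⟨r, h1⟩
  · exact (H.eq_roots_of_isClique hm (H.isClique_of_hasNoCutVertex hS) hsub).le

/-! ### Weight centers and levels -/

theorem weightAt_root (H : IsStarProfile G m k h N root cop lev idx) {r : V} (hr : lev r = 0) :
    weightAt G r = ∑ v, lev v + (m - 1) * (1 + k * (h * N)) := by
  rw [weightAt, ← H.sum_root_ne (H.root_lt r), ← Finset.sum_add_distrib]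
  refine Finset.sum_congr rfl fun v _ => ?_
  rw [H.dist_eq (fun h => by have := h.2.1; omega), hr]
  simp only [add_zero]

/-- Moving from `v` to its root brings every vertex outside the chain closer by `lev v` and takes
those on the chain away by at most `lev v`. The chain has at most `h * N` vertices; the rest of the
graph has more, since there are at least two chains and at least one root. -/
theorem weightAt_root_lt (H : IsStarProfile G m k h N root cop lev idx) (hm : 0 < m)
    (hmk : 2 ≤ m * k) {r v : V} (hr : lev r = 0) (hv : 0 < lev v) :
    weightAt G r < weightAt G v := by
  classical
  obtain ⟨s, h1, h2⟩ := H.exists_root (H.root_lt v)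
  rw [H.weightAt_root hr, ← H.weightAt_root h1]
  have hterm : ∀ u, G.dist u s + lev v * (if SameChain root cop lev u v then 0 else 1) ≤
      G.dist u v + lev v * (if SameChain root cop lev u v then 1 else 0) := by
    intro u
    have h3 : ∀ x, ¬ SameChain root cop lev x s := fun x hx => by have := hx.2.1; omega
    by_cases h4 : SameChain root cop lev u v
    · have h5 := (H.connected hm).dist_triangle (u := u) (v := v) (w := s)
      rw [H.dist_eq (h3 v)] at h5
      simp only [h4, if_true, mul_zero, mul_one]
      simp only [h2, if_true] at h5
      omega
    · rw [H.dist_eq (h3 u), H.dist_eq h4, h1, h2]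
      simp only [h4, if_false]
      omega
  have hsum := Finset.sum_le_sum fun u (_ : u ∈ Finset.univ) => hterm u
  rw [Finset.sum_add_distrib, Finset.sum_add_distrib, ← Finset.mul_sum, ← Finset.mul_sum] at hsum
  have hA := H.card_sameChain_le v
  have hAB := Finset.card_filter_add_card_filter_not (s := (Finset.univ : Finset V))
    (fun u => SameChain root cop lev u v)
  rw [Finset.card_univ, H.card_eq] at hAB
  have e1 : ∑ u, (if SameChain root cop lev u v then 1 else 0) =
      (Finset.univ.filter fun u => SameChain root cop lev u v).card := by
    rw [Finset.card_filter]
  have e2 : ∑ u, (if SameChain root cop lev u v then 0 else 1) =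
      (Finset.univ.filter fun u => ¬ SameChain root cop lev u v).card := by
    rw [Finset.card_filter]
    exact Finset.sum_congr rfl fun u _ => by split_ifs <;> simp_all
  rw [e1, e2] at hsum
  have h6 : 2 * (h * N) ≤ m * k * (h * N) := Nat.mul_le_mul_right _ hmk
  have h7 : lev v * ((Finset.univ.filter fun u => SameChain root cop lev u v).card + 1) ≤
      lev v * (Finset.univ.filter fun u => ¬ SameChain root cop lev u v).card :=
    Nat.mul_le_mul_left _ (by omega)
  rw [mul_add] at h7
  simp only [weightAt]
  omega

theorem weightCenters_eq (H : IsStarProfile G m k h N root cop lev idx) (hm : 0 < m)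
    (hmk : 2 ≤ m * k) : weightCenters G = {v | lev v = 0} := by
  obtain ⟨r, h1, h2⟩ := H.exists_root hm
  have hw : weight G = weightAt G r := by
    apply le_antisymm
    · exact Nat.sInf_le ⟨r, rfl⟩
    · have : Nonempty V := ⟨r⟩
      refine le_ciInf fun v => ?_
      rcases Nat.eq_zero_or_pos (lev v) with h3 | h3
      · rw [H.weightAt_root h1, H.weightAt_root h3]
      · exact (H.weightAt_root_lt hm hmk h1 h3).le
  ext v
  simp only [weightCenters, Set.mem_ofPred_eq, hw]
  constructor
  · intro h3
    by_contra h4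
    have := H.weightAt_root_lt hm hmk h1 (Nat.pos_of_ne_zero h4)
    omega
  · intro h3
    rw [H.weightAt_root h1, H.weightAt_root h3]

theorem epsilon_eq (H : IsStarProfile G m k h N root cop lev idx) (hm : 0 < m)
    (hmk : 2 ≤ m * k) : epsilon G = if m = 1 then 1 else 0 := by
  obtain ⟨r, h1, h2⟩ := H.exists_root hm
  have h4 : (weightCenters G).ncard = 1 ↔ m = 1 := by
    rw [H.weightCenters_eq hm hmk, Set.ncard_eq_one]
    constructor
    · rintro ⟨a, ha⟩
      by_contra hm1
      obtain ⟨s, h5, h6⟩ := H.exists_root (a := 1) (by omega)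
      have h7 : r ∈ ({a} : Set V) := ha ▸ h1
      have h8 : s ∈ ({a} : Set V) := ha ▸ h5
      rw [Set.mem_singleton_iff] at h7 h8
      rw [h8, ← h7] at h6
      omega
    · intro hm1
      refine ⟨r, Set.Subset.antisymm (fun v hv => ?_) (fun v hv => by rw [hv]; exact h1)⟩
      have h5 := H.root_lt v
      exact H.inj_root _ _ hv h1 (by omega)
  simp only [epsilon, h4]

theorem isCentralVertex_iff (H : IsStarProfile G m k h N root cop lev idx) (hm : 0 < m)
    (hmk : 2 ≤ m * k) (w : V) : IsCentralVertex G w ↔ lev w = 0 := by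
  rw [IsCentralVertex, H.weightCenters_eq hm hmk]
  constructor
  · rintro (h1 | ⟨⟨u, hu, v, hv, huv⟩, B, hB, hsub, hw⟩)
    · have : w ∈ {v | lev v = 0} := by rw [h1]; rfl
      exact this
    · have h1 := H.root_lt u
      have h2 := H.root_lt v
      have h3 : root u ≠ root v := fun h => huv (H.inj_root _ _ hu hv h)
      rw [H.eq_roots_of_isClique (by omega) (H.isClique_of_hasNoCutVertex hB.prop) hsub] at hw
      exact hw
  · intro hw
    by_cases hm1 : m = 1
    · refine Or.inl (Set.Subset.antisymm (fun v hv => ?_) (fun v hv => by rw [hv]; exact hw))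
      have h1 := H.root_lt v
      have h2 := H.root_lt w
      exact H.inj_root _ _ hv hw (by omega)
    · refine Or.inr ⟨?_, _, H.isBlock_roots (by omega), le_rfl, hw⟩
      obtain ⟨r, h1, h2⟩ := H.exists_root (a := 0) (by omega)
      obtain ⟨s, h3, h4⟩ := H.exists_root (a := 1) (by omega)
      exact ⟨r, h1, s, h3, fun h => by rw [h] at h2; omega⟩

theorem level_eq (H : IsStarProfile G m k h N root cop lev idx) (hm : 0 < m)
    (hmk : 2 ≤ m * k) (v : V) : level G v = lev v := by
  have hd : ∀ w, lev w = 0 → G.dist v w = lev v + if root v = root w then 0 else 1 := by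
    intro w hw
    rw [H.dist_eq (fun h => by have := h.2.1; omega), hw, add_zero]
  obtain ⟨r, h1, h2⟩ := H.exists_root (H.root_lt v)
  have hmem : lev v ∈ {d : ℕ | ∃ w : V, IsCentralVertex G w ∧ G.dist v w = d} :=
    ⟨r, (H.isCentralVertex_iff hm hmk r).2 h1, by rw [hd r h1, h2, if_pos rfl, add_zero]⟩
  refine le_antisymm (Nat.sInf_le hmem) (le_csInf ⟨_, hmem⟩ ?_)
  rintro d ⟨w, hw, rfl⟩
  rw [hd w ((H.isCentralVertex_iff hm hmk w).1 hw)]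
  exact Nat.le_add_right _ _

theorem lowerBound_eq (H : IsStarProfile G m k h N root cop lev idx) (hm : 0 < m) (hk : 0 < k)
    (hh : 0 < h) (hN : 0 < N) (hmk : 2 ≤ m * k) :
    lowerBound G = (m : ℤ) * k * h ^ 2 * N + ((m : ℤ) - 1) * (2 * (h : ℤ) + 1) + epsilon G := by
  have h1 : (2 * totalLevel G : ℤ) = m * k * N * (h * (h + 1)) := by
    rw [totalLevel, Finset.sum_congr rfl fun v _ => H.level_eq hm hmk v]
    exact_mod_cast H.sum_lev
  have h2 : ((G.diam : ℤ) + epsilon G) = 2 * h + 1 := by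
    rw [H.diam_eq hm hk hh hN hmk, H.epsilon_eq hm hmk]
    split_ifs <;> push_cast <;> ring
  rw [lowerBound, h1, h2, H.card_eq]
  push_cast
  ring

end IsStarProfile

/-! ### The span of a labeling is at least the lower bound -/

/-- Vertices are added in increasing order of their labels, `b` being the latest; the consecutive
gaps telescope. -/
theorem exists_span_ge {V : Type*} (f : V → ℕ) (L : V → ℤ) (D : ℤ)
    (hf : ∀ u v, u ≠ v → D - L u - L v ≤ |(f u : ℤ) - f v|) (S : Finset V) (hS : S.Nonempty) :
    ∃ a ∈ S, ∃ b ∈ S, (2 ≤ S.card → a ≠ b) ∧ (∀ x ∈ S, f x ≤ f b) ∧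
      ((S.card : ℤ) - 1) * D - 2 * ∑ x ∈ S, L x + L a + L b ≤ (f b : ℤ) - f a := by
  classical
  induction S using Finset.induction_on_max_value f with
  | empty => exact absurd hS Finset.not_nonempty_empty
  | insert x S hx hmax ih =>
    rcases S.eq_empty_or_nonempty with rfl | hne
    · exact ⟨x, by simp, x, by simp, by simp, by simp, by simp; linarith⟩
    · obtain ⟨a, ha, b, hb, -, h2, h3⟩ := ih hne
      refine ⟨a, Finset.mem_insert_of_mem ha, x, Finset.mem_insert_self _ _, fun _ => ?_, ?_, ?_⟩
      · rintro rfl; exact hx ha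
      · intro y hy
        rcases Finset.mem_insert.1 hy with rfl | hy
        exacts [le_rfl, hmax y hy]
      · have h4 := hf x b (by rintro rfl; exact hx hb)
        have h5 : (f b : ℤ) ≤ f x := by exact_mod_cast hmax b hb
        rw [abs_of_nonneg (by linarith)] at h4
        rw [Finset.card_insert_of_notMem hx, Finset.sum_insert hx]
        push_cast
        linarith

/-! ### Labels from a sequence of levels -/

/-- The labels of the members of a sequence of vertices with levels `lam`, when the labels of
consecutive members with levels `a` and `b` differ by `D - a - b`. -/
def seqLabel (D : ℕ) (lam : ℕ → ℕ) (i : ℕ) : ℕ :=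
  ∑ t ∈ Finset.range i, (D - lam t - lam (t + 1))

section seqLabel

variable {D : ℕ} {lam : ℕ → ℕ}

/-- The hypothesis `hD` makes the truncated subtractions exact. -/
theorem seqLabel_succ (hD : ∀ i, 2 * lam i ≤ D) (i : ℕ) :
    seqLabel D lam (i + 1) + lam i + lam (i + 1) = seqLabel D lam i + D := by
  have h1 := hD i
  have h2 := hD (i + 1)
  rw [seqLabel, Finset.sum_range_succ, ← seqLabel]
  omega

theorem seqLabel_mono : Monotone (seqLabel D lam) := fun _ _ hij =>
  Finset.sum_le_sum_of_subset (Finset.range_mono hij)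

theorem seqLabel_add_sum (hD : ∀ i, 2 * lam i ≤ D) (i : ℕ) :
    seqLabel D lam i + 2 * ∑ t ∈ Finset.range (i + 1), lam t = i * D + lam 0 + lam i := by
  induction i with
  | zero => simp [seqLabel]; omega
  | succ i ih =>
    have := seqLabel_succ hD i
    rw [Finset.sum_range_succ, add_mul]
    omega

end seqLabel

/-! ### The sequence of levels -/

section seqLevel

variable {m k h N : ℕ}

/-- In a round through all chains, the chains at even distance (in the order of the round) from
this one are used from their highest level downwards, the other ones from the lowest upwards. -/
def roundOffset (m k : ℕ) : ℕ := if m = 1 then k - 1 else 0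

/-- The level of the `j`-th of the vertices of positive level. -/
def roundLevel (m k h N j : ℕ) : ℕ :=
  if (j % (m * k) + roundOffset m k) % 2 = 0 then h - j / (m * k) / N else 1 + j / (m * k) / N

/-- The level of the `i`-th vertex: one root, then rounds through all chains, then the other
roots. -/
def seqLevel (m k h N i : ℕ) : ℕ :=
  if i = 0 ∨ m * k * (h * N) < i then 0 else roundLevel m k h N (i - 1)

theorem round_lt {j : ℕ} (hj : j < m * k * (h * N)) : j / (m * k) / N < h := by
  have : 0 < m * k := Nat.pos_of_ne_zero fun h0 => by simp [h0] at hj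
  rw [Nat.div_div_eq_div_mul]
  exact Nat.div_lt_of_lt_mul (lt_of_lt_of_eq hj (by ring))

theorem roundLevel_le {j : ℕ} (hj : j < m * k * (h * N)) : roundLevel m k h N j ≤ h := by
  have := round_lt hj
  rw [roundLevel]
  generalize j / (m * k) / N = τ at *
  split_ifs <;> omega

theorem seqLevel_le (i : ℕ) : seqLevel m k h N i ≤ h := by
  rw [seqLevel]
  split_ifs with h1
  · exact Nat.zero_le _
  · exact roundLevel_le (by omega)

theorem succ_mod_div (M : ℕ) (hM : 0 < M) (j : ℕ) :
    ((j + 1) % M = j % M + 1 ∧ (j + 1) / M = j / M) ∨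
      (j % M + 1 = M ∧ (j + 1) % M = 0 ∧ (j + 1) / M = j / M + 1) := by
  have h1 := Nat.mod_lt j hM
  rcases (Nat.succ_le_of_lt h1).lt_or_eq with h2 | h2
  · left
    have h3 : j + 1 = (j % M + 1) + M * (j / M) := by have := Nat.mod_add_div j M; omega
    constructor
    · rw [h3, Nat.add_mul_mod_self_left, Nat.mod_eq_of_lt h2]
    · rw [h3, Nat.add_mul_div_left _ _ hM, Nat.div_eq_of_lt h2, zero_add]
  · right
    have h3 : j + 1 = M * (j / M + 1) := by
      have := Nat.mod_add_div j M
      rw [mul_add, mul_one]; omega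
    refine ⟨h2, ?_, ?_⟩
    · rw [h3, Nat.mul_mod_right]
    · rw [h3, Nat.mul_div_cancel_left _ hM]

theorem round_step (M N : ℕ) (hM : 0 < M) (j : ℕ) :
    ((j + 1) % M = j % M + 1 ∧ (j + 1) / M / N = j / M / N) ∨
      (j % M + 1 = M ∧ (j + 1) % M = 0 ∧ j / M / N ≤ (j + 1) / M / N ∧
        (j + 1) / M / N ≤ j / M / N + 1) := by
  rcases succ_mod_div M hM j with ⟨h1, h2⟩ | ⟨h1, h2, h3⟩
  · exact Or.inl ⟨h1, by rw [h2]⟩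
  · refine Or.inr ⟨h1, h2, ?_, ?_⟩
    · rw [h3]; exact Nat.div_le_div_right (by omega)
    · rw [h3, Nat.succ_div]
      split_ifs <;> omega

/-- The hypotheses on the length `M` of a round and on the offset `s` that are used below. -/
theorem round_cases (hk : 0 < k) (hm1 : m = 1 → 3 ≤ k) (hm : 0 < m) :
    (m = 1 ∧ 3 ≤ m * k ∧ roundOffset m k + 1 = m * k) ∨
      (2 ≤ m ∧ 3 ≤ m * k ∧ roundOffset m k = 0) ∨
        (m = 2 ∧ k = 1 ∧ m * k = 2 ∧ roundOffset m k = 0) := by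
  rw [roundOffset]
  by_cases h1 : m = 1
  · left
    have := hm1 h1
    rw [if_pos h1, h1]
    omega
  · right
    rw [if_neg h1]
    by_cases h2 : 3 ≤ m * k
    · exact Or.inl ⟨by omega, h2, rfl⟩
    · right
      have h3 : m * 1 ≤ m * k := Nat.mul_le_mul_left _ hk
      have h4 : m = 2 := by omega
      subst h4
      exact ⟨rfl, by omega, by omega, rfl⟩

/-- The left side is the sum of the three consecutive pair sums. Inside a round a pair gives `h +
1`. Across a round boundary it gives at most `h + 2`, and `h + 2` only if the traversal advances a
level, so that `h ≥ 2`; or else two descending chains meet and it is at most `2h`. In this last case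
`m * k ≥ 3`, so only one of the three pairs crosses a boundary. -/
theorem roundLevel_window (hk : 0 < k) (hm1 : m = 1 → 3 ≤ k) (hm : 0 < m) {j : ℕ}
    (hj : j + 3 < m * k * (h * N)) :
    roundLevel m k h N j + 2 * roundLevel m k h N (j + 1) + 2 * roundLevel m k h N (j + 2) +
      roundLevel m k h N (j + 3) ≤ 4 * h + 2 := by
  have hM : 0 < m * k := Nat.mul_pos hm hk
  have t0 := round_lt (m := m) (k := k) (h := h) (N := N) (j := j) (by omega)
  have t3 := round_lt (m := m) (k := k) (h := h) (N := N) hj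
  have s0 := round_step (m * k) N hM j
  have s1 := round_step (m * k) N hM (j + 1)
  have s2 := round_step (m * k) N hM (j + 2)
  have c := round_cases hk hm1 hm
  simp only [roundLevel]
  simp only [add_assoc, Nat.reduceAdd] at *
  generalize roundOffset m k = s at *
  generalize m * k = M at *
  generalize j / M / N = τ0 at *
  generalize (j + 1) / M / N = τ1 at *
  generalize (j + 2) / M / N = τ2 at *
  generalize (j + 3) / M / N = τ3 at *
  have q0 : j % M < M := Nat.mod_lt _ hM
  generalize j % M = q0 at *
  generalize (j + 1) % M = q1 at *
  generalize (j + 2) % M = q2 at *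
  generalize (j + 3) % M = q3 at *
  clear hj
  rcases s0 with s0 | s0 <;> rcases s1 with s1 | s1 <;> rcases s2 with s2 | s2 <;>
    rcases c with c | c | c <;> split_ifs <;> omega

theorem roundLevel_add_roundLevel_succ (hk : 0 < k) (hm : 0 < m) {j : ℕ}
    (hj : j % (m * k) + 1 < m * k) (hj' : j < m * k * (h * N)) :
    roundLevel m k h N j + roundLevel m k h N (j + 1) = h + 1 := by
  have hM : 0 < m * k := Nat.mul_pos hm hk
  have t0 := round_lt hj'
  have s0 := round_step (m * k) N hM j
  simp only [roundLevel]
  generalize j / (m * k) / N = τ0 at *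
  generalize (j + 1) / (m * k) / N = τ1 at *
  generalize roundOffset m k = s at *
  split_ifs <;> omega

theorem seqLevel_window (hk : 0 < k) (hm1 : m = 1 → 3 ≤ k) (hm : 0 < m) (hh : 0 < h) (i : ℕ) :
    seqLevel m k h N i + 2 * seqLevel m k h N (i + 1) + 2 * seqLevel m k h N (i + 2) +
      seqLevel m k h N (i + 3) ≤ 4 * h + 2 := by
  have hM : 2 ≤ m * k := by have := round_cases hk hm1 hm; omega
  have l0 := seqLevel_le (m := m) (k := k) (h := h) (N := N) i
  have l1 := seqLevel_le (m := m) (k := k) (h := h) (N := N) (i + 1)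
  have l2 := seqLevel_le (m := m) (k := k) (h := h) (N := N) (i + 2)
  have l3 := seqLevel_le (m := m) (k := k) (h := h) (N := N) (i + 3)
  have hz : ∀ i, m * k * (h * N) < i → seqLevel m k h N i = 0 := fun i hi => by
    rw [seqLevel, if_pos (Or.inr hi)]
  have hp : ∀ j, j < m * k * (h * N) → seqLevel m k h N (j + 1) = roundLevel m k h N j :=
    fun j hj => by
      rw [seqLevel, if_neg (by omega), Nat.add_sub_cancel]
  by_cases h3 : m * k * (h * N) < i + 2
  · have := hz _ h3
    have := hz (i + 3) (by omega)
    omega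
  rcases Nat.eq_zero_or_pos i with rfl | hi
  · have e0 : seqLevel m k h N 0 = 0 := by rw [seqLevel, if_pos (Or.inl rfl)]
    have e1 := hp 0 (by omega)
    have e2 := hp 1 (by omega)
    have := roundLevel_add_roundLevel_succ (h := h) (N := N) hk hm (j := 0) (by simp; omega) (by omega)
    simp only [zero_add, Nat.reduceAdd] at *
    omega
  obtain ⟨j, rfl⟩ : ∃ j, i = j + 1 := ⟨i - 1, by omega⟩
  by_cases h4 : m * k * (h * N) < j + 4
  · have e0 := hz (j + 4) h4
    have h5 : m * k * (h * N) = (j + 1) + 2 := by omega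
    have e1 := hp (j + 1) (by omega)
    have e2 := hp (j + 2) (by omega)
    -- The last two vertices of positive level lie in one round, because `m * k ≥ 2` divides the
    -- number of such vertices.
    have := roundLevel_add_roundLevel_succ (h := h) (N := N) hk hm (j := j + 1) (by
      by_contra hcon
      have h6 := Nat.mod_lt (j + 1) (show m * k > 0 by omega)
      have h7 : m * k ∣ j + 2 := ⟨(j + 1) / (m * k) + 1, by
        have := Nat.mod_add_div (j + 1) (m * k)
        rw [mul_add, mul_one]; omega⟩
      have h8 : m * k ∣ j + 2 + 1 := ⟨h * N, h5.symm⟩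
      have := Nat.le_of_dvd one_pos ((Nat.dvd_add_right h7).1 h8)
      omega) (by omega)
    simp only [add_assoc, Nat.reduceAdd] at *
    omega
  · have := roundLevel_window (h := h) (N := N) hk hm1 hm (j := j) (by omega)
    have e0 := hp j (by omega)
    have e1 := hp (j + 1) (by omega)
    have e2 := hp (j + 2) (by omega)
    have e3 := hp (j + 3) (by omega)
    simp only [add_assoc, Nat.reduceAdd] at *
    omega

/-- With two chains of edges, the levels of three consecutive vertices satisfy a better bound. -/
theorem roundLevel_two {h j : ℕ} (hj : j + 2 < 2 * h) :
    roundLevel 2 1 h 1 j + 2 * roundLevel 2 1 h 1 (j + 1) + roundLevel 2 1 h 1 (j + 2) ≤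
      2 * h + 1 := by
  -- With one vertex per level every new round advances a level, so the pair across the boundary
  -- adds up to `h` only; with the pair inside a round this makes `2 * h + 1`.
  simp only [roundLevel, roundOffset, mul_one, Nat.div_one]
  split_ifs <;> omega

/-- For a single root the offset `k - 1` makes the last chain of each round descend, so the sequence
ends on level 1, which is the value of `ε` required at that end. -/
theorem seqLevel_last (hm : m = 1) (hk : 0 < k) (hh : 0 < h) (hN : 0 < N) :
    seqLevel m k h N (m * k * (h * N)) = 1 := by
  subst hm
  have h1 : 0 < 1 * k * (h * N) := by positivity
  obtain ⟨k, rfl⟩ : ∃ i, k = i + 1 := ⟨k - 1, by omega⟩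
  obtain ⟨h, rfl⟩ : ∃ i, h = i + 1 := ⟨h - 1, by omega⟩
  obtain ⟨N, rfl⟩ : ∃ i, N = i + 1 := ⟨N - 1, by omega⟩
  rw [seqLevel, if_neg (by omega), roundLevel, roundOffset, if_pos rfl]
  simp only [one_mul] at h1 ⊢
  have e : (k + 1) * ((h + 1) * (N + 1)) - 1 = k + (k + 1) * (N + (N + 1) * h) := by
    rw [Nat.sub_eq_iff_eq_add h1]; ring
  rw [e, Nat.add_mul_mod_self_left, Nat.mod_eq_of_lt (Nat.lt_succ_self k),
    Nat.add_mul_div_left _ _ (Nat.succ_pos k), Nat.div_eq_of_lt (Nat.lt_succ_self k), zero_add,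
    Nat.add_mul_div_left _ _ (Nat.succ_pos N), Nat.div_eq_of_lt (Nat.lt_succ_self N),
    if_pos (by omega)]
  omega

end seqLevel
namespace IsStarProfile

variable {V : Type*} [Fintype V] {G : SimpleGraph V} {m k h N : ℕ} {root cop lev idx : V → ℕ}

/-! ### The position of a vertex in the sequence -/

/-- The position, among the vertices of positive level, of the one with the given coordinates. -/
def chainPos (m k h N root cop lev idx : ℕ) : ℕ :=
  (cop * m + root) + m * k *
    (idx + N * if (cop * m + root + roundOffset m k) % 2 = 0 then h - lev else lev - 1)

/-- The position in the sequence of the vertex with the given coordinates. -/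
def starPos (m k h N root cop lev idx : ℕ) : ℕ :=
  if lev = 0 then (if root + 1 = m then 0 else m * k * (h * N) + 1 + root)
  else chainPos m k h N root cop lev idx + 1

section coordinates

variable {a c l i : ℕ}

theorem chainIndex_lt (ha : a < m) (hc : c < k) : c * m + a < m * k := by
  calc c * m + a < c * m + m := by omega
    _ = m * (c + 1) := by ring
    _ ≤ m * k := Nat.mul_le_mul_left _ hc

theorem chainPos_mod (ha : a < m) (hc : c < k) :
    chainPos m k h N a c l i % (m * k) = c * m + a := by
  rw [chainPos, Nat.add_mul_mod_self_left, Nat.mod_eq_of_lt (chainIndex_lt ha hc)]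

theorem chainPos_div (ha : a < m) (hc : c < k) : chainPos m k h N a c l i / (m * k) =
    i + N * if (c * m + a + roundOffset m k) % 2 = 0 then h - l else l - 1 := by
  have h1 := chainIndex_lt ha hc
  rw [chainPos, Nat.add_mul_div_left _ _ (by omega), Nat.div_eq_of_lt h1, zero_add]

theorem chainPos_div_div (ha : a < m) (hc : c < k) (hi : i < N) :
    chainPos m k h N a c l i / (m * k) / N =
      if (c * m + a + roundOffset m k) % 2 = 0 then h - l else l - 1 := by
  rw [chainPos_div ha hc, Nat.add_mul_div_left _ _ (by omega), Nat.div_eq_of_lt hi, zero_add]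

theorem chainPos_lt (ha : a < m) (hc : c < k) (hi : i < N) (hl : 0 < l) (hl' : l ≤ h) :
    chainPos m k h N a c l i < m * k * (h * N) := by
  have h1 := chainIndex_lt ha hc
  have h3 : chainPos m k h N a c l i / (m * k) < h * N := by
    rw [chainPos_div ha hc]
    calc _ < N + N * (h - 1) := by
          refine Nat.add_lt_add_of_lt_of_le hi (Nat.mul_le_mul_left _ ?_)
          split_ifs <;> omega
      _ = N * (h - 1 + 1) := by ring
      _ = h * N := by rw [Nat.sub_add_cancel (by omega), mul_comm]
  rw [mul_comm]
  exact (Nat.div_lt_iff_lt_mul (by omega)).1 h3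

theorem roundLevel_chainPos (ha : a < m) (hc : c < k) (hi : i < N) (hl : 0 < l) (hl' : l ≤ h) :
    roundLevel m k h N (chainPos m k h N a c l i) = l := by
  rw [roundLevel, chainPos_mod ha hc, chainPos_div_div ha hc hi]
  split_ifs <;> omega

theorem chainPos_add_mod (ha : a < m) : (chainPos m k h N a c l i + m) % m = a := by
  rw [Nat.add_mod_right, chainPos, mul_assoc m k, Nat.add_mul_mod_self_left,
    Nat.mul_add_mod_self_right, Nat.mod_eq_of_lt ha]

/-- The residue modulo `m * k` encodes root and copy, `roundLevel` returns the level, and the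
quotient then yields the index. -/
theorem chainPos_injective {a' c' l' i' : ℕ} (ha : a < m) (hc : c < k) (hi : i < N) (hl : 0 < l)
    (hl' : l ≤ h) (ha' : a' < m) (hc' : c' < k) (hi' : i' < N) (hl0 : 0 < l') (hl0' : l' ≤ h)
    (heq : chainPos m k h N a c l i = chainPos m k h N a' c' l' i') :
    a = a' ∧ c = c' ∧ l = l' ∧ i = i' := by
  have h1 := roundLevel_chainPos ha hc hi hl hl'
  rw [heq, roundLevel_chainPos ha' hc' hi' hl0 hl0'] at h1
  have h2 := chainPos_mod (h := h) (N := N) (l := l) (i := i) ha hc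
  rw [heq, chainPos_mod ha' hc'] at h2
  have h3 : a = a' := by
    have := congrArg (· % m) h2
    simpa [Nat.mul_add_mod_self_right, Nat.mod_eq_of_lt ha, Nat.mod_eq_of_lt ha'] using this.symm
  subst h3 h1
  have h4 : c = c' := Nat.eq_of_mul_eq_mul_right (by omega : 0 < m) (by omega)
  subst h4
  have h5 := chainPos_div (h := h) (N := N) (l := l') (i := i) ha hc
  rw [heq, chainPos_div ha hc] at h5
  exact ⟨rfl, rfl, rfl, by omega⟩

end coordinates

/-- The position of a vertex. -/
def pos (m k h N : ℕ) (root cop lev idx : V → ℕ) (v : V) : ℕ :=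
  starPos m k h N (root v) (cop v) (lev v) (idx v)

theorem pos_cases (H : IsStarProfile G m k h N root cop lev idx) (v : V) :
    (lev v = 0 ∧ root v + 1 = m ∧ pos m k h N root cop lev idx v = 0) ∨
    (lev v = 0 ∧ root v + 1 < m ∧ pos m k h N root cop lev idx v = m * k * (h * N) + 1 + root v) ∨
    (0 < lev v ∧ cop v < k ∧ idx v < N ∧ pos m k h N root cop lev idx v =
      chainPos m k h N (root v) (cop v) (lev v) (idx v) + 1 ∧
      chainPos m k h N (root v) (cop v) (lev v) (idx v) < m * k * (h * N)) := by
  have h1 := H.root_lt v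
  rcases Nat.eq_zero_or_pos (lev v) with h0 | h0
  · by_cases h2 : root v + 1 = m
    · left
      simp [pos, starPos, h0, h2]
    · right; left
      exact ⟨h0, by omega, by simp [pos, starPos, h0, h2]⟩
  · right; right
    refine ⟨h0, H.cop_lt v h0, H.idx_lt v h0, ?_,
      chainPos_lt h1 (H.cop_lt v h0) (H.idx_lt v h0) h0 (H.lev_le v)⟩
    rw [pos, starPos, if_neg h0.ne']

theorem seqLevel_pos (H : IsStarProfile G m k h N root cop lev idx) (v : V) :
    seqLevel m k h N (pos m k h N root cop lev idx v) = lev v := by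
  rcases H.pos_cases v with ⟨h1, h2, h3⟩ | ⟨h1, h2, h3⟩ | ⟨h1, h2, h3, h4, h5⟩
  · rw [h3, seqLevel, if_pos (Or.inl rfl), h1]
  · rw [h3, seqLevel, if_pos (Or.inr (by omega)), h1]
  · rw [h4, seqLevel, if_neg (by omega), Nat.add_sub_cancel,
      roundLevel_chainPos (H.root_lt v) h2 h3 h1 (H.lev_le v)]

theorem pos_injective (H : IsStarProfile G m k h N root cop lev idx) :
    Function.Injective (pos m k h N root cop lev idx) := by
  intro u v huv
  have hu := H.seqLevel_pos u
  rw [huv, H.seqLevel_pos v] at hu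
  rcases H.pos_cases u with ⟨h1, h2, h3⟩ | ⟨h1, h2, h3⟩ | ⟨h1, h2, h3, h4, h5⟩ <;>
    rcases H.pos_cases v with ⟨g1, g2, g3⟩ | ⟨g1, g2, g3⟩ | ⟨g1, g2, g3, g4, g5⟩ <;>
    try omega
  · exact H.inj_root _ _ h1 g1 (by omega)
  · exact H.inj_root _ _ h1 g1 (by omega)
  · obtain ⟨e1, e2, e3, e4⟩ := chainPos_injective (H.root_lt u) h2 h3 h1 (H.lev_le u) (H.root_lt v)
      g2 g3 g1 (H.lev_le v) (by omega)
    exact H.inj _ _ h1 e3 e1 e2 e4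

theorem pos_lt (H : IsStarProfile G m k h N root cop lev idx) (v : V) :
    pos m k h N root cop lev idx v < m + m * k * (h * N) := by
  have := H.root_lt v
  rcases H.pos_cases v with ⟨h1, h2, h3⟩ | ⟨h1, h2, h3⟩ | ⟨h1, h2, h3, h4, h5⟩ <;> omega

theorem sum_seqLevel (H : IsStarProfile G m k h N root cop lev idx) :
    ∑ t ∈ Finset.range (m + m * k * (h * N)), seqLevel m k h N t = ∑ v, lev v := by
  classical
  have himg : Finset.univ.image (pos m k h N root cop lev idx) =
      Finset.range (m + m * k * (h * N)) := by
    apply Finset.eq_of_subset_of_card_le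
    · intro i hi
      obtain ⟨v, -, rfl⟩ := Finset.mem_image.1 hi
      exact Finset.mem_range.2 (H.pos_lt v)
    · rw [Finset.card_range, Finset.card_image_of_injective _ H.pos_injective, Finset.card_univ,
        H.card_eq]
  rw [← himg, Finset.sum_image fun _ _ _ _ hxy => H.pos_injective hxy]
  exact Finset.sum_congr rfl fun v _ => H.seqLevel_pos v

/-- Root `m - 1` opens the sequence, the chains start at root 0 and end at root `m - 1`, and roots
`0, …, m - 2` follow: the cyclic order is never broken. For `m ≥ 2` consecutive vertices thus have
different roots. -/
theorem root_eq_pos_mod (H : IsStarProfile G m k h N root cop lev idx) (v : V) :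
    root v = (pos m k h N root cop lev idx v + (m - 1)) % m := by
  have h0 := H.root_lt v
  rcases H.pos_cases v with ⟨h1, h2, h3⟩ | ⟨h1, h2, h3⟩ | ⟨h1, h2, h3, h4, h5⟩
  · rw [h3, zero_add, Nat.mod_eq_of_lt (by omega)]; omega
  · rw [h3, show m * k * (h * N) + 1 + root v + (m - 1) = root v + m + m * (k * (h * N)) by
      rw [mul_assoc m k]; omega, Nat.add_mul_mod_self_left, Nat.add_mod_right,
      Nat.mod_eq_of_lt h0]
  · rw [h4, add_assoc, Nat.add_sub_cancel' (by omega), chainPos_add_mod h0]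

theorem dvd_of_sameChain (H : IsStarProfile G m k h N root cop lev idx) {u v : V}
    (huv : SameChain root cop lev u v)
    (hlt : pos m k h N root cop lev idx u < pos m k h N root cop lev idx v) :
    m * k ∣ pos m k h N root cop lev idx v - pos m k h N root cop lev idx u := by
  obtain ⟨h1, h2, h3, h4⟩ := huv
  rcases H.pos_cases u with hu | hu | ⟨-, u2, u3, u4, -⟩
  · omega
  · omega
  rcases H.pos_cases v with hv | hv | ⟨-, v2, v3, v4, -⟩
  · omega
  · omega
  have e : chainPos m k h N (root u) (cop u) (lev u) (idx u) % (m * k) =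
      chainPos m k h N (root v) (cop v) (lev v) (idx v) % (m * k) := by
    rw [chainPos_mod (H.root_lt u) u2, chainPos_mod (H.root_lt v) v2, h3, h4]
  rw [u4, v4] at hlt ⊢
  rw [Nat.add_sub_add_right]
  exact (Nat.modEq_iff_dvd' (by omega)).1 e

/-! ### The radio number -/

/-- The labeling that attains the lower bound. -/
def label (m k h N : ℕ) (root cop lev idx : V → ℕ) (v : V) : ℕ :=
  seqLabel (2 * h + 1) (seqLevel m k h N) (pos m k h N root cop lev idx v)

theorem label_add_diam_le (H : IsStarProfile G m k h N root cop lev idx) (hm : 0 < m) (hk : 0 < k)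
    (hh : 0 < h) (hN : 0 < N) (hm1 : m = 1 → 3 ≤ k) (hm2 : m = 2 → k = 1 → N = 1) {u v : V}
    (hlt : pos m k h N root cop lev idx u < pos m k h N root cop lev idx v) :
    label m k h N root cop lev idx u + G.diam + 1 ≤
      label m k h N root cop lev idx v + G.dist u v := by
  have hc := round_cases hk hm1 hm
  rw [H.diam_eq hm hk hh hN (by omega)]
  have huv : u ≠ v := by rintro rfl; omega
  have hd : 0 < G.dist u v := (H.connected hm).pos_dist_of_ne huv
  have hD : ∀ i, 2 * seqLevel m k h N i ≤ 2 * h + 1 := fun i => by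
    have := seqLevel_le (m := m) (k := k) (h := h) (N := N) i
    omega
  have hs := seqLabel_succ hD
  have hlu := H.seqLevel_pos u
  have hlv := H.seqLevel_pos v
  have hru := H.root_eq_pos_mod u
  have hrv := H.root_eq_pos_mod v
  have hdvd := fun hsc : SameChain root cop lev u v => H.dvd_of_sameChain hsc hlt
  have hld := fun hsc : ¬ SameChain root cop lev u v => H.le_dist hsc
  have hpu := H.pos_cases u
  have hpv := H.pos_cases v
  simp only [label]
  set i := pos m k h N root cop lev idx u
  set j := pos m k h N root cop lev idx v
  have h1 := hs i
  have h2 := hs (i + 1)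
  have h3 := hs (i + 2)
  have hw := seqLevel_window (N := N) hk hm1 hm hh i
  simp only [add_assoc, Nat.reduceAdd] at h1 h2 h3 hw
  rcases (by omega : j = i + 1 ∨ j = i + 2 ∨ i + 3 ≤ j) with hj | hj | hj
  -- Consecutive places: the chains differ because `m * k > 1`, and for `m ≥ 2` the roots differ
  -- too, which pays for the extra 1 in the diameter. The inequality is then an equality.
  · have hns : ¬ SameChain root cop lev u v := fun hsc => by
      have h4 := Nat.le_of_dvd (by omega) (hdvd hsc)
      omega
    have h4 := hld hns
    rw [hj] at hlv ⊢
    by_cases hm1' : m = 1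
    · rw [if_pos hm1']
      omega
    · have hne : root u ≠ root v := fun heq => by
        rw [hru, hrv, hj, add_right_comm] at heq
        have h5 : (i + (m - 1) + 1) ≡ (i + (m - 1)) [MOD m] := heq.symm
        have h6 := (Nat.modEq_iff_dvd' (by omega)).1 h5.symm
        have := Nat.le_of_dvd (by omega) h6
        omega
      simp only [hm1', hne, if_false] at h4 ⊢
      omega
  · rw [hj] at hlv ⊢
    by_cases hsc : SameChain root cop lev u v
    -- Here `m * k` divides 2, which leaves only `(m, k) = (2, 1)`. The gap is at least `2 * (2h +
    -- 1) - (2h + 1) = d(G)`, and the distance supplies the missing 1.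
    · have h4 := Nat.le_of_dvd (by omega) (hdvd hsc)
      have h5 : m = 2 ∧ k = 1 := by omega
      obtain ⟨rfl, rfl⟩ := h5
      obtain rfl := hm2 rfl rfl
      have h6 := hsc.1
      have h7 := hsc.2.1
      have hp : ∀ j, j < 2 * h → seqLevel 2 1 h 1 (j + 1) = roundLevel 2 1 h 1 j := fun j hj => by
        rw [seqLevel, if_neg (by omega), Nat.add_sub_cancel]
      have h8 := roundLevel_two (h := h) (j := i - 1) (by omega)
      have e0 := hp (i - 1) (by omega)
      have e1 := hp (i - 1 + 1) (by omega)
      have e2 := hp (i - 1 + 2) (by omega)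
      rw [show i - 1 + 1 = i by omega] at *
      rw [show i - 1 + 2 = i + 1 by omega] at *
      simp only [add_assoc, Nat.reduceAdd] at *
      simp only [OfNat.ofNat_ne_one, if_false]
      omega
    -- The outer levels cancel against the distance; what is left is at least `2 * (2h + 1) - 2h =
    -- 2h + 2 ≥ d(G) + 1`.
    · have h4 := hld hsc
      have h5 := hD (i + 1)
      have h6 := seqLevel_le (m := m) (k := k) (h := h) (N := N) (i + 1)
      split_ifs at h4 ⊢ <;> omega
  -- Labels increase along the sequence, so the bound at distance three in the order covers all
  -- later vertices.
  · have h4 := seqLabel_mono (D := 2 * h + 1) (lam := seqLevel m k h N) hj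
    split_ifs <;> omega

theorem isRadioLabeling_label (H : IsStarProfile G m k h N root cop lev idx) (hm : 0 < m)
    (hk : 0 < k) (hh : 0 < h) (hN : 0 < N) (hm1 : m = 1 → 3 ≤ k)
    (hm2 : m = 2 → k = 1 → N = 1) :
    IsRadioLabeling G G.diam (label m k h N root cop lev idx) := by
  intro u v huv
  rcases (H.pos_injective.ne huv).lt_or_gt with hlt | hlt
  · have := H.label_add_diam_le hm hk hh hN hm1 hm2 hlt
    rw [abs_sub_comm]
    refine le_trans ?_ (le_abs_self _)
    omega
  · have := H.label_add_diam_le hm hk hh hN hm1 hm2 hlt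
    rw [SimpleGraph.dist_comm] at this
    refine le_trans ?_ (le_abs_self _)
    omega

theorem lowerBound_eq_seqLabel (H : IsStarProfile G m k h N root cop lev idx) (hm : 0 < m)
    (hk : 0 < k) (hh : 0 < h) (hN : 0 < N) (hmk : 2 ≤ m * k) : lowerBound G =
      seqLabel (2 * h + 1) (seqLevel m k h N) (m + m * k * (h * N) - 1) := by
  have h1 := seqLabel_add_sum (D := 2 * h + 1) (lam := seqLevel m k h N) (fun i => by
    have := seqLevel_le (m := m) (k := k) (h := h) (N := N) i
    omega) (m + m * k * (h * N) - 1)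
  rw [Nat.sub_add_cancel (by omega), H.sum_seqLevel] at h1
  have h2 : seqLevel m k h N 0 = 0 := by rw [seqLevel, if_pos (Or.inl rfl)]
  -- The last vertex is on level 1 if `m = 1`, and it is a root otherwise.
  have h3 : seqLevel m k h N (m + m * k * (h * N) - 1) = epsilon G := by
    rw [H.epsilon_eq hm hmk]
    split_ifs with hm1
    · rw [show m + m * k * (h * N) - 1 = m * k * (h * N) by omega]
      exact seqLevel_last hm1 hk hh hN
    · rw [seqLevel, if_pos (Or.inr (by omega))]
  have h4 : ((G.diam : ℤ) + epsilon G) = 2 * h + 1 := by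
    rw [H.diam_eq hm hk hh hN hmk, H.epsilon_eq hm hmk]
    split_ifs <;> push_cast <;> ring
  have h5 : ((m + m * k * (h * N) - 1 : ℕ) : ℤ) = (m + m * k * (h * N) : ℕ) - 1 := by
    rw [Nat.cast_sub (by omega)]; simp
  rw [lowerBound, h4, H.card_eq, totalLevel, Finset.sum_congr rfl fun v _ => H.level_eq hm hmk v]
  rw [h2, h3] at h1
  zify at h1
  rw [h5] at h1
  push_cast at h1 ⊢
  linarith

theorem lowerBound_le_labelSpan (H : IsStarProfile G m k h N root cop lev idx) (hm : 0 < m)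
    (hk : 0 < k) (hh : 0 < h) (hN : 0 < N) (hmk : 2 ≤ m * k) {f : V → ℕ}
    (hf : IsRadioLabeling G G.diam f) : lowerBound G ≤ labelSpan f := by
  have hne := (H.connected hm).nonempty
  have h4 : ((G.diam : ℤ) + epsilon G) = 2 * h + 1 := by
    rw [H.diam_eq hm hk hh hN hmk, H.epsilon_eq hm hmk]
    split_ifs <;> push_cast <;> ring
  -- The 1 added to the diameter in the radio condition is `ε` when `m = 1`; for `m ≥ 2` it is used
  -- up by the edge between two roots.
  obtain ⟨a, -, b, -, hab, -, hspan⟩ := exists_span_ge f (fun v => (lev v : ℤ))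
    ((G.diam : ℤ) + epsilon G) (fun u v huv => by
      have h1 := hf u v huv
      have h2 := H.dist_le u v
      have h3 := H.root_lt u
      have h5 := H.root_lt v
      rw [H.epsilon_eq hm hmk]
      refine le_trans ?_ h1
      split_ifs at h2 ⊢ <;> omega) Finset.univ Finset.univ_nonempty
  have hp : 0 < m * k * (h * N) := Nat.mul_pos (by omega) (Nat.mul_pos hh hN)
  have hab' : a ≠ b := hab (by rw [Finset.card_univ, H.card_eq]; omega)
  have heps : (epsilon G : ℤ) ≤ lev a + lev b := by
    rw [H.epsilon_eq hm hmk]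
    split_ifs with hm1
    · by_contra hcon
      have h1 := H.root_lt a
      have h2 := H.root_lt b
      exact hab' (H.inj_root a b (by omega) (by omega) (by omega))
    · positivity
  have hle : ((f a : ℤ) - f b).natAbs ≤ labelSpan f :=
    Finset.le_sup (f := fun p : V × V => ((f p.1 : ℤ) - (f p.2 : ℤ)).natAbs) (Finset.mem_univ (a, b))
  rw [lowerBound, totalLevel, Finset.sum_congr rfl fun v _ => H.level_eq hm hmk v]
  rw [Finset.card_univ] at hspan
  push_cast
  generalize (((Fintype.card V : ℤ) - 1) * ((G.diam : ℤ) + epsilon G)) = X at *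
  omega

theorem radioNumber_eq (H : IsStarProfile G m k h N root cop lev idx) (hm : 0 < m)
    (hk : 0 < k) (hh : 0 < h) (hN : 0 < N) (hm1 : m = 1 → 3 ≤ k)
    (hm2 : m = 2 → k = 1 → N = 1) : (radioNumber G : ℤ) = lowerBound G := by
  have hmk : 2 ≤ m * k := by have := round_cases hk hm1 hm; omega
  apply le_antisymm
  · rw [H.lowerBound_eq_seqLabel hm hk hh hN hmk]
    have h1 : radioNumber G ≤ labelSpan (label m k h N root cop lev idx) :=
      Nat.sInf_le ⟨_, H.isRadioLabeling_label hm hk hh hN hm1 hm2, rfl⟩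
    refine Nat.cast_le.2 (h1.trans (Finset.sup_le fun p _ => ?_))
    have h2 : ∀ v, label m k h N root cop lev idx v ≤
        seqLabel (2 * h + 1) (seqLevel m k h N) (m + m * k * (h * N) - 1) := fun v =>
      seqLabel_mono (by have := H.pos_lt v; omega)
    have h3 := h2 p.1
    have h4 := h2 p.2
    omega
  · obtain ⟨f, hf, hs⟩ := Nat.sInf_mem (radioKNumber_set_nonempty G G.diam)
    rw [radioNumber, radioKNumber, ← hs]
    exact H.lowerBound_le_labelSpan hm hk hh hN hmk hf

end IsStarProfile

end RadioBlock

theorem theorem6 (m k h n : ℕ) (hm : 1 ≤ m) (hk : 1 ≤ k) (hh : 1 ≤ h) (hn : 2 ≤ n)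
    (hm1 : m = 1 → 3 ≤ k) (hm2 : m = 2 → k = 1 → n = 2)
    (t : Fin m → Fin k → RadioBlock.CliquePathVertex h n)
    (ht : ∀ a c, RadioBlock.IsTailVertex (t a c)) :
    RadioBlock.IsLowerBoundBlockGraph (RadioBlock.extendedStar m k h n t) ∧
      (RadioBlock.radioNumber (RadioBlock.extendedStar m k h n t) : ℤ) =
        (m : ℤ) * k * h ^ 2 * ((n : ℤ) - 1) + ((m : ℤ) - 1) * (2 * (h : ℤ) + 1)
          + (RadioBlock.epsilon (RadioBlock.extendedStar m k h n t) : ℤ) := by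
  obtain ⟨root, cop, lev, idx, H⟩ := RadioBlock.exists_isStarProfile hh hn t ht
  have hN : 0 < n - 1 := by omega
  have hmk : 2 ≤ m * k := by have := RadioBlock.round_cases hk hm1 hm; omega
  have hrn := H.radioNumber_eq hm hk hh hN hm1 (fun h1 h2 => by have := hm2 h1 h2; omega)
  refine ⟨⟨H.isBlockGraph hm, hrn⟩, ?_⟩
  rw [hrn, H.lowerBound_eq hm hk hh hN hmk, Nat.cast_sub (by omega), Nat.cast_one]
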